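/- Let $\Sigma$ be a closed (compact, Hausdorff, without boundary) smooth $n$-manifold with a fixed smooth Riemannian metric $g_0$, and let $\vec\Phi\colon\Sigma\to\mathbb{R}^m$ be a $W^{1,\infty}$ weak immersion: $\vec\Phi\in W^{1,\infty}(\Sigma,\mathbb{R}^m)$ and there is a constant $\Lambda>0$ such that for a.e. $q\in\Sigma$ and all $X\in T_q\Sigma$ $$\Lambda^{-1}g_0(X,X)\le |d\vec\Phi_q(X)|^2\le \Lambda\, g_0(X,X),$$ where $d\vec\Phi$ is the weak differential. We take for $\vec\Phi$ its continuous representative. Assume that $d\vec\Phi\in VMO(\Sigma)$, that is, for every smooth coordinate system $\phi\colon V\to\phi(V)\subset\mathbb{R}^n$, $V\subset\Sigma$ open, and every $\xi\in C_c^\infty(V)$, the weak gradient $G=\nabla\big((\xi\vec\Phi)\circ\phi^{-1}\big)$ satisfies $$\lim_{r\to0^+}\ \sup_{\substack{0<\rho\le r\\ B_\rho\subset\phi(V)}}\ \frac1{|B_\rho|}\int_{B_\rho}\Big|G-\frac1{|B_\rho|}\int_{B_\rho}G\Big|=0,$$ the supremum being over balls $B_\rho$ of radius $\rho$ contained in $\phi(V)$.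 Let $g_{\vec\Phi}(X,Y)=\langle d\vec\Phi(X),d\vec\Phi(Y)\rangle$ be the induced metric, let $d\mathrm{vol}_{g_{\vec\Phi}}$ be its volume measure (given by $\sqrt{\det (g_{ij})}\,dx$ in local coordinates), and let $B_r(y)$ denote the ball in $\mathbb{R}^m$ and $B^n$ the unit ball of $\mathbb{R}^n$. Then for every $y\in\mathbb{R}^m$ the set $\vec\Phi^{-1}(y)$ is finite, and the density $$\theta_y:=\lim_{r\to0^+}\frac{1}{r^n|B^n|}\int_\Sigma \mathbf 1_{\vec\Phi^{-1}(B_r(y))}\,d\mathrm{vol}_{g_{\vec\Phi}}$$ exists and equals $\mathrm{Card}(\vec\Phi^{-1}(y))$. In particular $\theta_y$ is a non-negative integer. -/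

import Mathlib

open MeasureTheory Filter Topology Set
open scoped Manifold ContDiff ENNReal

noncomputable section

namespace WeakImm

/-! ### Weak derivatives and vanishing mean oscillation in Euclidean domains -/

section Euclidean

variable {n : ℕ} {F : Type*} [NormedAddCommGroup F] [NormedSpace ℝ F]

/-- `f` belongs to `W^{1,1}_loc(U)` and `G` is its weak derivative on the open set `U`:
both are locally integrable on `U`, and
`∫_U (∂_v ψ) f = - ∫_U ψ (G v)` for all test functions `ψ ∈ C_c^∞(U)` and all vectors `v`. -/
structure HasWeakFDerivOn (U : Set (EuclideanSpace ℝ (Fin n)))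
    (f : EuclideanSpace ℝ (Fin n) → F)
    (G : EuclideanSpace ℝ (Fin n) → (EuclideanSpace ℝ (Fin n) →L[ℝ] F)) : Prop where
  locallyIntegrableOn : LocallyIntegrableOn f U volume
  locallyIntegrableOn_deriv : LocallyIntegrableOn G U volume
  integral_eq : ∀ ψ : EuclideanSpace ℝ (Fin n) → ℝ, ContDiff ℝ ∞ ψ → HasCompactSupport ψ →
    tsupport ψ ⊆ U → ∀ v : EuclideanSpace ℝ (Fin n),
      ∫ x in U, (fderiv ℝ ψ x v) • f x = - ∫ x in U, ψ x • G x v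

/-- The modulus of mean oscillation `β_r(f)` of `f` on `U`: the supremum of
`⨍_B |f - ⨍_B f|` over all balls `B ⊆ U` of radius at most `r`.
It takes values in `[0, ∞]`; a ball on which `f` is not integrable contributes `∞`. -/
def oscModulus (U : Set (EuclideanSpace ℝ (Fin n))) (f : EuclideanSpace ℝ (Fin n) → F)
    (r : ℝ) : ℝ≥0∞ :=
  ⨆ (x : EuclideanSpace ℝ (Fin n)) (ρ : ℝ) (_ : 0 < ρ ∧ ρ ≤ r ∧ Metric.ball x ρ ⊆ U),
    ⨍⁻ y in Metric.ball x ρ, ‖f y - (⨍ z in Metric.ball x ρ, f z ∂volume)‖ₑ ∂volume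

/-- `f ∈ VMO(U)`. -/
def IsVMO (U : Set (EuclideanSpace ℝ (Fin n))) (f : EuclideanSpace ℝ (Fin n) → F) : Prop :=
  LocallyIntegrableOn f U volume ∧ Tendsto (oscModulus U f) (𝓝[>] 0) (𝓝 0)

end Euclidean

/-! ### Volume measures, weak differentials and weak immersions on manifolds -/

section Manifold

variable {n m : ℕ} {M : Type*} [TopologicalSpace M] [ChartedSpace (EuclideanSpace ℝ (Fin n)) M]

/-- The coefficients `g_{ij}` at `x` of a field `g` of forms on tangent spaces, in the local
coordinates given by the chart `e`. -/
def chartGram (e : OpenPartialHomeomorph M (EuclideanSpace ℝ (Fin n)))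
    (g : ∀ q : M, TangentSpace (𝓡 n) q → TangentSpace (𝓡 n) q → ℝ)
    (x : EuclideanSpace ℝ (Fin n)) : Matrix (Fin n) (Fin n) ℝ :=
  Matrix.of fun i j =>
    g (e.symm x)
      (mfderiv (𝓡 n) (𝓡 n) e.symm x (EuclideanSpace.basisFun (Fin n) ℝ i))
      (mfderiv (𝓡 n) (𝓡 n) e.symm x (EuclideanSpace.basisFun (Fin n) ℝ j))

/-- The measure `√(det g_{ij}) dx` on the domain of the chart `e`, as a measure on `M`. -/
def chartVolume [MeasurableSpace M] (e : OpenPartialHomeomorph M (EuclideanSpace ℝ (Fin n)))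
    (g : ∀ q : M, TangentSpace (𝓡 n) q → TangentSpace (𝓡 n) q → ℝ) : Measure M :=
  ((volume.restrict e.target).withDensity
    fun x => ENNReal.ofReal (Real.sqrt (chartGram e g x).det)).map e.symm

/-- The Riemannian volume measure `dvol_g` of a (possibly only measurable) metric `g`.
By the change of variables formula the measures `√(det g_{ij}) dx` of two smooth charts coincide
on the overlap of the charts, so their supremum in the lattice of measures is the measure
on `M` that restricts to `√(det g_{ij}) dx` on every smooth chart. -/
def volMeasure [MeasurableSpace M]
    (g : ∀ q : M, TangentSpace (𝓡 n) q → TangentSpace (𝓡 n) q → ℝ) : Measure M :=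
  ⨆ e ∈ IsManifold.maximalAtlas (𝓡 n) ∞ M, chartVolume e g

/-- `Φ ∈ W^{1,1}_loc(M, ℝ^m)` and `D` is (a representative of) its weak differential `dΦ`:
in every smooth chart `e`, the map `x ↦ D_{e⁻¹(x)} ∘ d(e⁻¹)_x` is a weak derivative
of `Φ ∘ e⁻¹`. -/
def IsWeakDifferential (Φ : M → EuclideanSpace ℝ (Fin m))
    (D : ∀ q : M, TangentSpace (𝓡 n) q →L[ℝ] EuclideanSpace ℝ (Fin m)) : Prop :=
  ∀ e ∈ IsManifold.maximalAtlas (𝓡 n) ∞ M,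
    HasWeakFDerivOn e.target (Φ ∘ e.symm)
      (fun x => (D (e.symm x)).comp (mfderiv (𝓡 n) (𝓡 n) e.symm x))

/-- `dΦ ∈ VMO(M)`: for every smooth chart `e` and every `ξ ∈ C_c^∞` supported in
the domain of `e`, the weak gradient of `(ξ Φ) ∘ e⁻¹` belongs to `VMO` of the target of `e`. -/
def DifferentialIsVMO (n : ℕ) {M : Type*} [TopologicalSpace M]
    [ChartedSpace (EuclideanSpace ℝ (Fin n)) M] (Φ : M → EuclideanSpace ℝ (Fin m)) : Prop :=
  ∀ e ∈ IsManifold.maximalAtlas (𝓡 n) ∞ M,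
    ∀ ξ : M → ℝ, ContMDiff (𝓡 n) 𝓘(ℝ, ℝ) ∞ ξ → HasCompactSupport ξ → tsupport ξ ⊆ e.source →
      ∃ G : EuclideanSpace ℝ (Fin n) →
          (EuclideanSpace ℝ (Fin n) →L[ℝ] EuclideanSpace ℝ (Fin m)),
        HasWeakFDerivOn e.target ((fun q => ξ q • Φ q) ∘ e.symm) G ∧ IsVMO e.target G

variable [IsManifold (𝓡 n) ∞ M] [MeasurableSpace M]

/-- `Φ` is a `W^{1,∞}` weak immersion of `M`, with weak differential `D`, where `g₀` is the
smooth reference metric. -/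
structure IsWeakImmersion
    (g₀ : Bundle.ContMDiffRiemannianMetric (𝓡 n) ∞ (EuclideanSpace ℝ (Fin n))
      (fun q : M => TangentSpace (𝓡 n) q))
    (Φ : M → EuclideanSpace ℝ (Fin m))
    (D : ∀ q : M, TangentSpace (𝓡 n) q →L[ℝ] EuclideanSpace ℝ (Fin m)) : Prop where
  /-- `Φ` has weak differential `D`. -/
  isWeakDifferential : IsWeakDifferential Φ D
  /-- `Φ ∈ L^∞`. -/
  memLp : MemLp Φ ⊤ (volMeasure fun q X Y => g₀.inner q X Y)
  /-- `dΦ ∈ L^∞`. -/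
  bounded : ∃ C : ℝ, ∀ᵐ q ∂(volMeasure fun q X Y => g₀.inner q X Y),
    ∀ X : TangentSpace (𝓡 n) q, ‖D q X‖ ^ 2 ≤ C * g₀.inner q X X
  /-- The two-sided comparison of `|dΦ(X)|²` with `g₀(X, X)`. -/
  immersion : ∃ Λ : ℝ, 0 < Λ ∧ ∀ᵐ q ∂(volMeasure fun q X Y => g₀.inner q X Y),
    ∀ X : TangentSpace (𝓡 n) q,
      Λ⁻¹ * g₀.inner q X X ≤ ‖D q X‖ ^ 2 ∧ ‖D q X‖ ^ 2 ≤ Λ * g₀.inner q X X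

/-- `Vol(E) = ∫_M 1_{Φ⁻¹(E)} dvol_{g_Φ}`, where `g_Φ(X, Y) = ⟨dΦ(X), dΦ(Y)⟩` and `D = dΦ`. -/
def imageVolume (Φ : M → EuclideanSpace ℝ (Fin m))
    (D : ∀ q : M, TangentSpace (𝓡 n) q →L[ℝ] EuclideanSpace ℝ (Fin m))
    (E : Set (EuclideanSpace ℝ (Fin m))) : ℝ≥0∞ :=
  ∫⁻ q, (Φ ⁻¹' E).indicator (fun _ => 1) q ∂(volMeasure fun q X Y => inner ℝ (D q X) (D q Y))

/-- The density at `y` exists and equals `θ`, i.e.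
`Vol(B_r(y)) / (r^n |B^n|) → θ` as `r → 0⁺`. -/
def HasDensityAt (Φ : M → EuclideanSpace ℝ (Fin m))
    (D : ∀ q : M, TangentSpace (𝓡 n) q →L[ℝ] EuclideanSpace ℝ (Fin m))
    (y : EuclideanSpace ℝ (Fin m)) (θ : ℝ≥0∞) : Prop :=
  Tendsto (fun r : ℝ => imageVolume Φ D (Metric.ball y r) /
      (ENNReal.ofReal (r ^ n) * volume (Metric.ball (0 : EuclideanSpace ℝ (Fin n)) 1)))
    (𝓝[>] 0) (𝓝 θ)

end Manifold

end WeakImm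

end

/-!
The map `Φ` is studied in a chart near a point `p`, where it becomes a continuous function `f` on an
open subset of `ℝⁿ` whose weak derivative `G` satisfies `lam ‖v‖ ≤ ‖G x v‖ ≤ Lam ‖v‖` almost
everywhere and has vanishing mean oscillation (`IsVMOImmersionOn`,
`IsWeakImmersion.exists_isVMOImmersionOn`).

The central point is that such an `f` is, at every small scale `ρ` and uniformly in the base point,
`η ρ`-close on a ball of radius `ρ` to an affine map whose linear part `A` is the mean of `G`
(`IsVMOImmersionOn.exists_approx`). This needs neither a Poincaré nor a Morrey inequality. Since `G`
is bounded, `f` is Lipschitz (`HasWeakFDerivOn.norm_sub_le`), so mollifying it at scale `s ρ` moves it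
by at most `Lam s ρ`. The derivative of the mollification is an average of `G` over a ball of radius
`s ρ`, so it differs from `A` by at most a multiple of `s⁻ⁿ` times the mean oscillation of `G` at
scale `ρ` (`HasWeakFDerivOn.exists_hasFDerivAt_mollify`). Choosing first `s` and then `ρ` small makes
both errors small (`exists_affine_approx`). As `G` is within its mean oscillation of `A` at some
point, `A` inherits the bounds `lam / 2 ‖v‖ ≤ ‖A v‖` and `‖A‖ ≤ Lam + lam`.

Applied at the scale of the distance of two points, the approximation shows that `f` expands
distances by at least the factor `lam / 4`, so it is locally injective
(`IsVMOImmersionOn.exists_antilipschitz`). The fibres of `Φ` are therefore discrete, and finite by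
compactness. Applied at `x₀` at a scale comparable to `r`, it shows that the preimage of the ball of
radius `r` about `f x₀` lies between the ellipsoids `‖A (x - x₀)‖ < r (1 ± η c)`. The weighted volume
of such an ellipsoid is that of a Euclidean ball (`jacobian_mul_volume_ellipsoid`), and the Jacobian
of `G` may be replaced by that of `A` since their difference is small in the mean. Hence `f` has
density one at `x₀` (`IsVMOImmersionOn.tendsto_density`).

On the manifold, the volume measure agrees on the domain of a chart with its coordinate expression,
by the change of variables formula (`volMeasure_apply_of_subset`). The preimage of a small ball about
`y` splits into disjoint pieces near the points of the fibre, and each contributes one to the density.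
-/

namespace WeakImm

/-! ### Mollification of functions with a weak derivative -/

/-- Euclidean `n`-space. -/
abbrev Eucl (n : ℕ) := EuclideanSpace ℝ (Fin n)

section Mollify

variable {n : ℕ} {F : Type*} [NormedAddCommGroup F] [NormedSpace ℝ F] [CompleteSpace F]
  {U : Set (Eucl n)} {f : Eucl n → F} {G : Eucl n → (Eucl n →L[ℝ] F)}

lemma tsupport_normed_sub_subset (φ : ContDiffBump (0 : Eucl n)) (x : Eucl n) :
    tsupport (fun z => φ.normed volume (x - z)) ⊆ Metric.closedBall x φ.rOut := by
  refine closure_minimal ?_ Metric.isClosed_closedBall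
  intro z hz
  have : x - z ∈ Function.support (φ.normed volume) := hz
  rw [φ.support_normed_eq] at this
  rw [Metric.mem_closedBall, dist_comm, dist_eq_norm]
  exact (mem_ball_zero_iff.1 this).le

lemma hasCompactSupport_normed_sub (φ : ContDiffBump (0 : Eucl n)) (x : Eucl n) :
    HasCompactSupport (fun z => φ.normed volume (x - z)) :=
  (isCompact_closedBall x φ.rOut).of_isClosed_subset (isClosed_tsupport _)
    (tsupport_normed_sub_subset φ x)

lemma contDiff_normed_sub (φ : ContDiffBump (0 : Eucl n)) (x : Eucl n) :
    ContDiff ℝ ∞ (fun z => φ.normed volume (x - z)) :=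
  φ.contDiff_normed.comp (contDiff_const.sub contDiff_id)

lemma fderiv_normed_sub (φ : ContDiffBump (0 : Eucl n)) (x z : Eucl n) :
    fderiv ℝ (fun z => φ.normed volume (x - z)) z = - fderiv ℝ (φ.normed volume) (x - z) := by
  have h1 : HasFDerivAt (φ.normed volume) (fderiv ℝ (φ.normed volume) (x - z)) (x - z) :=
    ((φ.contDiff_normed (μ := volume) (n := 1)).differentiable one_ne_zero _).hasFDerivAt
  have h2 : HasFDerivAt (fun z => x - z) (-(ContinuousLinearMap.id ℝ (Eucl n))) z := by
    simpa using (hasFDerivAt_id z).const_sub x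
  have h3 := (h1.comp z h2).fderiv
  rw [Function.comp_def] at h3
  rw [h3]
  ext v
  simp

lemma normed_sub_eq_zero (φ : ContDiffBump (0 : Eucl n)) {x z : Eucl n}
    (hz : z ∉ Metric.ball x φ.rOut) : φ.normed volume (x - z) = 0 := by
  have : x - z ∉ Function.support (φ.normed volume) := by
    rw [φ.support_normed_eq]
    intro h'
    apply hz
    rw [Metric.mem_ball, dist_comm, dist_eq_norm]
    exact mem_ball_zero_iff.1 h'
  simpa using this

lemma setIntegral_normed_sub (φ : ContDiffBump (0 : Eucl n)) (x : Eucl n) :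
    ∫ z in Metric.ball x φ.rOut, φ.normed volume (x - z) = 1 := by
  rw [setIntegral_eq_integral_of_forall_compl_eq_zero fun z hz => normed_sub_eq_zero φ hz,
    integral_sub_left_eq_self (fun z => φ.normed volume z) volume x, φ.integral_normed]

/-- Mollifying `f` at `x` averages its weak derivative: the derivative of the mollification
differs from a given linear map `A` by at most the corresponding weighted average of
`‖G - A‖`. -/
lemma HasWeakFDerivOn.exists_hasFDerivAt_mollify (h : HasWeakFDerivOn U f G)
    {K : Set (Eucl n)} (hK : IsCompact K) (hKU : K ⊆ U) (φ : ContDiffBump (0 : Eucl n))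
    {x : Eucl n} (hx : Metric.closedBall x φ.rOut ⊆ K) (A : Eucl n →L[ℝ] F) :
    ∃ f' : Eucl n →L[ℝ] F,
      HasFDerivAt (convolution (φ.normed volume) (K.indicator f)
        (ContinuousLinearMap.lsmul ℝ ℝ) volume) f' x ∧
      ‖f' - A‖ ≤ ∫ z in Metric.ball x φ.rOut, φ.normed volume (x - z) * ‖G z - A‖ := by
  have hfK : IntegrableOn f K := h.locallyIntegrableOn.integrableOn_compact_subset hKU hK
  have hGK : IntegrableOn G K := h.locallyIntegrableOn_deriv.integrableOn_compact_subset hKU hK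
  have hg : LocallyIntegrable (K.indicator f) volume :=
    ((integrable_indicator_iff hK.measurableSet).2 hfK).locallyIntegrable
  have hder := φ.hasCompactSupport_normed (μ := volume) |>.hasFDerivAt_convolution_left
    (ContinuousLinearMap.lsmul ℝ ℝ) (φ.contDiff_normed (n := 1)) hg x
  have hex : ConvolutionExistsAt (fderiv ℝ (φ.normed volume)) (K.indicator f) x
      (ContinuousLinearMap.precompL (Eucl n) (ContinuousLinearMap.lsmul ℝ ℝ)) volume :=
    ((φ.hasCompactSupport_normed (μ := volume)).fderiv ℝ).convolutionExists_left _
      ((φ.contDiff_normed (n := 1)).continuous_fderiv one_ne_zero) hg x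
  refine ⟨_, hder, ?_⟩
  set B := Metric.ball x φ.rOut with hB
  have hBK : B ⊆ K := Metric.ball_subset_closedBall.trans hx
  set ψ : Eucl n → ℝ := fun z => φ.normed volume (x - z) with hψ
  have hψ0 : ∀ z, z ∉ B → ψ z = 0 := fun z hz => normed_sub_eq_zero φ hz
  have hψc : Continuous ψ := (contDiff_normed_sub φ x).continuous
  have hGB : IntegrableOn (fun z => G z - A) B :=
    (hGK.mono_set hBK).sub (integrableOn_const (by simpa [hB] using measure_ball_lt_top.ne))
  have hψn : ∀ z, 0 ≤ ψ z := fun z => φ.nonneg_normed _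
  have hψb : ∃ C, ∀ z, ‖ψ z‖ ≤ C :=
    (hasCompactSupport_normed_sub φ x).exists_bound_of_continuous hψc
  have hψint : ∫ z in B, ψ z = 1 := setIntegral_normed_sub φ x
  have hI : IntegrableOn (fun z => ψ z • (G z - A)) B := by
    obtain ⟨C, hC⟩ := hψb
    exact hGB.bdd_smul C hψc.aestronglyMeasurable (Eventually.of_forall hC)
  have hIψ : IntegrableOn ψ B :=
    (hψc.integrable_of_hasCompactSupport (hasCompactSupport_normed_sub φ x)).integrableOn
  -- the derivative of the mollification is the weighted average of `G`
  have key : convolution (fderiv ℝ (φ.normed volume)) (K.indicator f)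
      (ContinuousLinearMap.precompL (Eucl n) (ContinuousLinearMap.lsmul ℝ ℝ)) volume x
      = A + ∫ z in B, ψ z • (G z - A) := by
    ext1 v
    rw [convolution_eq_swap, ContinuousLinearMap.integral_apply hex.integrable_swap,
      add_apply, ContinuousLinearMap.integral_apply hI]
    have e1 : ∀ z, ((ContinuousLinearMap.precompL (Eucl n) (ContinuousLinearMap.lsmul ℝ ℝ))
        (fderiv ℝ (φ.normed volume) (x - z)) (K.indicator f z)) v
        = - ((fderiv ℝ ψ z v) • f z) := by
      intro z
      rw [ContinuousLinearMap.precompL_apply, hψ, fderiv_normed_sub]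
      by_cases hz : z ∈ K
      · simp [indicator_of_mem hz]
      · have : z ∉ tsupport ψ := fun h' => hz (hx (tsupport_normed_sub_subset φ x h'))
        have h0 : fderiv ℝ ψ z = 0 :=
          image_eq_zero_of_notMem_tsupport (fun h' => this (tsupport_fderiv_subset ℝ h'))
        rw [hψ, fderiv_normed_sub] at h0
        have h1 : fderiv ℝ (φ.normed volume) (x - z) = 0 := neg_eq_zero.1 h0
        simp [h1]
    simp_rw [e1]
    rw [integral_neg]
    have hsub : tsupport ψ ⊆ U := (tsupport_normed_sub_subset φ x).trans (hx.trans hKU)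
    have e2 : ∫ z, (fderiv ℝ ψ z v) • f z = ∫ z in U, (fderiv ℝ ψ z v) • f z := by
      rw [setIntegral_eq_integral_of_forall_compl_eq_zero]
      intro z hz
      have h0 : fderiv ℝ ψ z = 0 :=
        image_eq_zero_of_notMem_tsupport
          (fun h' => hz (hsub (tsupport_fderiv_subset ℝ h')))
      simp [h0]
    rw [e2, h.integral_eq ψ (contDiff_normed_sub φ x) (hasCompactSupport_normed_sub φ x) hsub v,
      neg_neg]
    have e3 : ∫ z in U, ψ z • G z v = ∫ z in B, ψ z • G z v := by
      rw [setIntegral_eq_integral_of_forall_compl_eq_zero,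
        setIntegral_eq_integral_of_forall_compl_eq_zero]
      · intro z hz; simp [hψ0 z hz]
      · intro z hz; simp [hψ0 z (fun h' => hz (hKU (hBK h')))]
    rw [e3]
    have e4 : ∀ z, (ψ z • (G z - A)) v = ψ z • G z v - ψ z • A v := by
      intro z; simp [smul_sub]
    simp_rw [e4]
    have i1 : IntegrableOn (fun z => ψ z • A v) B := hIψ.smul_const _
    have i2 : IntegrableOn (fun z => ψ z • G z v) B := by
      have := (hI.apply_continuousLinearMap v).add i1
      refine this.congr (Eventually.of_forall fun z => ?_)
      simp [smul_sub]
    rw [integral_sub i2 i1, integral_smul_const, hψint]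
    simp
  rw [key, add_sub_cancel_left]
  refine (norm_integral_le_integral_norm _).trans (le_of_eq ?_)
  refine integral_congr_ae (Eventually.of_forall fun z => ?_)
  simp only [norm_smul, Real.norm_of_nonneg (hψn z)]
  rfl

/-- The standard bump at scale `s`. -/
noncomputable def bumpAt (n : ℕ) {s : ℝ} (hs : 0 < s) : ContDiffBump (0 : Eucl n) where
  rIn := s / 2
  rOut := s
  rIn_pos := by positivity
  rIn_lt_rOut := by linarith

/-- A continuous function whose weak derivative is bounded by `Λ` is `Λ`-Lipschitz on balls. -/
lemma HasWeakFDerivOn.norm_sub_le (h : HasWeakFDerivOn U f G) (hf : ContinuousOn f U)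
    {x₀ : Eucl n} {R R' Λ : ℝ} (hR : R' < R) (hball : Metric.closedBall x₀ R ⊆ U)
    (hΛ : ∀ᵐ x, x ∈ U → ‖G x‖ ≤ Λ) {x y : Eucl n}
    (hx : x ∈ Metric.ball x₀ R') (hy : y ∈ Metric.ball x₀ R') :
    ‖f y - f x‖ ≤ Λ * ‖y - x‖ := by
  set K := Metric.closedBall x₀ R with hKdef
  have hK : IsCompact K := isCompact_closedBall _ _
  have hfK : IntegrableOn f K := h.locallyIntegrableOn.integrableOn_compact_subset hball hK
  have hmeas : AEStronglyMeasurable (K.indicator f) volume :=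
    ((integrable_indicator_iff hK.measurableSet).2 hfK).aestronglyMeasurable
  have hsub : ∀ z ∈ Metric.ball x₀ R', ∀ s ≤ R - R', Metric.closedBall z s ⊆ K := by
    intro z hz s hs
    refine Metric.closedBall_subset_closedBall' ?_
    have := (Metric.mem_ball.1 hz).le
    linarith
  refine le_of_forall_pos_le_add fun ε hε => ?_
  -- mollify at a scale `s` at which `f` oscillates by at most `ε / 2` about `x` and `y`
  have hc : ∀ z ∈ Metric.ball x₀ R', ∃ δ > 0, ∀ w ∈ Metric.ball z δ,
      dist (K.indicator f w) (K.indicator f z) ≤ ε / 2 := by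
    intro z hz
    have hKz : K ∈ 𝓝 z := mem_of_superset (Metric.closedBall_mem_nhds z (sub_pos.2 hR))
      (hsub z hz _ le_rfl)
    have hcz : ContinuousAt (K.indicator f) z := by
      have : ContinuousAt f z := hf.continuousAt (mem_of_superset hKz hball)
      refine this.congr ?_
      filter_upwards [hKz] with w hw
      rw [indicator_of_mem hw]
    obtain ⟨δ, hδ, h'⟩ := Metric.continuousAt_iff.1 hcz (ε / 2) (by positivity)
    exact ⟨δ, hδ, fun w hw => (h' hw).le⟩
  obtain ⟨δ₁, hδ₁, h1⟩ := hc x hx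
  obtain ⟨δ₂, hδ₂, h2⟩ := hc y hy
  obtain ⟨s, hs, hsm⟩ : ∃ s : ℝ, 0 < s ∧ s ≤ min (R - R') (min δ₁ δ₂) :=
    ⟨_, lt_min (sub_pos.2 hR) (lt_min hδ₁ hδ₂), le_rfl⟩
  have hs1 : s ≤ R - R' := hsm.trans (min_le_left _ _)
  have hs2 : s ≤ δ₁ := hsm.trans ((min_le_right _ _).trans (min_le_left _ _))
  have hs3 : s ≤ δ₂ := hsm.trans ((min_le_right _ _).trans (min_le_right _ _))
  set φ := bumpAt n hs
  set g := convolution (φ.normed volume) (K.indicator f)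
        (ContinuousLinearMap.lsmul ℝ ℝ) volume with hg
  have d1 : dist (g x) (K.indicator f x) ≤ ε / 2 :=
    φ.dist_normed_convolution_le hmeas fun w hw => h1 w (Metric.ball_subset_ball hs2 hw)
  have d2 : dist (g y) (K.indicator f y) ≤ ε / 2 :=
    φ.dist_normed_convolution_le hmeas fun w hw => h2 w (Metric.ball_subset_ball hs3 hw)
  have hxK : x ∈ K := hsub x hx _ le_rfl (Metric.mem_closedBall_self (sub_pos.2 hR).le)
  have hyK : y ∈ K := hsub y hy _ le_rfl (Metric.mem_closedBall_self (sub_pos.2 hR).le)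
  rw [indicator_of_mem hxK, dist_eq_norm] at d1
  rw [indicator_of_mem hyK, dist_eq_norm] at d2
  have hg' : ∀ z ∈ Metric.ball x₀ R', ∃ f' : Eucl n →L[ℝ] F, HasFDerivAt g f' z ∧ ‖f'‖ ≤ Λ := by
    intro z hz
    obtain ⟨f', hf', hb⟩ := h.exists_hasFDerivAt_mollify hK hball φ (hsub z hz s hs1) 0
    refine ⟨f', hf', ?_⟩
    rw [sub_zero] at hb
    refine hb.trans ?_
    have hzK : Metric.ball z φ.rOut ⊆ K := Metric.ball_subset_closedBall.trans (hsub z hz s hs1)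
    have hGK : IntegrableOn G (Metric.ball z φ.rOut) :=
      (h.locallyIntegrableOn_deriv.integrableOn_compact_subset hball hK).mono_set hzK
    have hψi : Integrable (fun w => φ.normed volume (z - w)) :=
      (contDiff_normed_sub φ z).continuous.integrable_of_hasCompactSupport
        (hasCompactSupport_normed_sub φ z)
    obtain ⟨C, hC⟩ := (hasCompactSupport_normed_sub φ z).exists_bound_of_continuous
      (contDiff_normed_sub φ z).continuous
    calc ∫ w in Metric.ball z φ.rOut, φ.normed volume (z - w) * ‖G w - 0‖
        ≤ ∫ w in Metric.ball z φ.rOut, φ.normed volume (z - w) * Λ := by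
          refine setIntegral_mono_on_ae ?_ (hψi.integrableOn.mul_const _)
            measurableSet_ball ?_
          · simp only [sub_zero]
            exact hGK.norm.bdd_mul (c := C)
              (contDiff_normed_sub φ z).continuous.aestronglyMeasurable (Eventually.of_forall hC)
          · filter_upwards [hΛ] with w hw hwB
            rw [sub_zero]
            exact mul_le_mul_of_nonneg_left (hw (hball (hzK hwB))) (φ.nonneg_normed _)
      _ = Λ := by
          rw [integral_mul_const, setIntegral_normed_sub, one_mul]
  choose! g' hg1 hg2 using hg'
  have d3 : ‖g y - g x‖ ≤ Λ * ‖y - x‖ :=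
    (convex_ball x₀ R').norm_image_sub_le_of_norm_hasFDerivWithin_le
      (fun z hz => (hg1 z hz).hasFDerivWithinAt) hg2 hx hy
  calc ‖f y - f x‖ = ‖(g y - g x) + (g x - f x) - (g y - f y)‖ := by congr 1; abel
    _ ≤ ‖g y - g x‖ + ‖g x - f x‖ + ‖g y - f y‖ :=
      (_root_.norm_sub_le _ _).trans (add_le_add_left (norm_add_le _ _) _)
    _ ≤ Λ * ‖y - x‖ + ε := by linarith

end Mollify

/-! ### Affine approximation from small mean oscillation -/

section Affine

variable {n : ℕ} {F : Type*} [NormedAddCommGroup F] [NormedSpace ℝ F]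

/-- On the open set `U`, `f` is continuous with weak derivative `G`, satisfying
`lam ‖v‖ ≤ ‖G x v‖ ≤ Lam ‖v‖` almost everywhere and having vanishing mean oscillation. -/
structure IsVMOImmersionOn (U : Set (Eucl n)) (f : Eucl n → F) (G : Eucl n → (Eucl n →L[ℝ] F))
    (lam Lam : ℝ) : Prop where
  isOpen : IsOpen U
  continuousOn : ContinuousOn f U
  hasWeakFDerivOn : HasWeakFDerivOn U f G
  lam_pos : 0 < lam
  Lam_nonneg : 0 ≤ Lam
  bounds : ∀ᵐ x, x ∈ U → ∀ v, lam * ‖v‖ ≤ ‖G x v‖ ∧ ‖G x v‖ ≤ Lam * ‖v‖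
  tendsto_oscModulus : Tendsto (oscModulus U G) (𝓝[>] 0) (𝓝 0)

variable {U : Set (Eucl n)} {f : Eucl n → F} {G : Eucl n → (Eucl n →L[ℝ] F)} {lam Lam : ℝ}

lemma IsVMOImmersionOn.norm_le (h : IsVMOImmersionOn U f G lam Lam) :
    ∀ᵐ x, x ∈ U → ‖G x‖ ≤ Lam := by
  filter_upwards [h.bounds] with x hx hxU
  exact (G x).opNorm_le_bound h.Lam_nonneg fun v => (hx hxU v).2

variable [CompleteSpace F]

/-- If the weak derivative of a Lipschitz function is close in `L¹`-mean to a linear map `A` on a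
ball of radius `ρ`, then on the half ball the function is uniformly close, relative to `ρ`, to an
affine map with linear part `A`. -/
lemma exists_affine_approx (n : ℕ) {Λ η : ℝ} (hΛ : 0 ≤ Λ) (hη : 0 < η) :
    ∃ ε > 0, ∀ {U : Set (Eucl n)} {f : Eucl n → F} {G : Eucl n → (Eucl n →L[ℝ] F)} {x : Eucl n}
      {ρ : ℝ} {A : Eucl n →L[ℝ] F}, HasWeakFDerivOn U f G → 0 < ρ →
      Metric.closedBall x ρ ⊆ U →
      (∀ y ∈ Metric.ball x ρ, ∀ z ∈ Metric.ball x ρ, ‖f y - f z‖ ≤ Λ * ‖y - z‖) →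
      ∫ z in Metric.ball x ρ, ‖G z - A‖ ≤ ε * volume.real (Metric.ball x ρ) →
      ∀ x' ∈ Metric.ball x (ρ / 2), ‖f x' - f x - A (x' - x)‖ ≤ η * ρ := by
  -- the mollification scale is `s * ρ`; its bump function is bounded by a multiple of `s⁻ⁿ`,
  -- which is why `s` has to be fixed before `ε`
  obtain ⟨s, hs, hs2, hsη⟩ : ∃ s : ℝ, 0 < s ∧ s ≤ 1 / 2 ∧ 2 * Λ * s ≤ η / 2 := by
    refine ⟨min (1 / 2) (η / (4 * (Λ + 1))), by positivity, min_le_left _ _, ?_⟩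
    have h1 : min (1 / 2) (η / (4 * (Λ + 1))) ≤ η / (4 * (Λ + 1)) := min_le_right _ _
    calc 2 * Λ * min (1 / 2) (η / (4 * (Λ + 1))) ≤ 2 * (Λ + 1) * (η / (4 * (Λ + 1))) := by
          gcongr; linarith
      _ = η / 2 := by field_simp; ring
  refine ⟨η * (s / 2) ^ n, by positivity, ?_⟩
  intro U f G x ρ A h hρ hU hlip hA x' hx'
  set K := Metric.closedBall x ρ with hKdef
  have hK : IsCompact K := isCompact_closedBall _ _
  have hfK : IntegrableOn f K := h.locallyIntegrableOn.integrableOn_compact_subset hU hK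
  have hGK : IntegrableOn G K := h.locallyIntegrableOn_deriv.integrableOn_compact_subset hU hK
  have hmeas : AEStronglyMeasurable (K.indicator f) volume :=
    ((integrable_indicator_iff hK.measurableSet).2 hfK).aestronglyMeasurable
  have hsρ : 0 < s * ρ := by positivity
  have hsρ2 : s * ρ ≤ ρ / 2 := by nlinarith
  have hsub : ∀ z ∈ Metric.ball x (ρ / 2), Metric.closedBall z (s * ρ) ⊆ K := by
    intro z hz
    refine Metric.closedBall_subset_closedBall' ?_
    have := (Metric.mem_ball.1 hz).le
    linarith
  have hsub' : ∀ z ∈ Metric.ball x (ρ / 2), Metric.ball z (s * ρ) ⊆ Metric.ball x ρ := by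
    intro z hz
    refine Metric.ball_subset_ball' ?_
    have := (Metric.mem_ball.1 hz).le
    linarith
  set φ := bumpAt n hsρ with hφ
  set g := convolution (φ.normed volume) (K.indicator f)
        (ContinuousLinearMap.lsmul ℝ ℝ) volume with hg
  have hclose : ∀ z ∈ Metric.ball x (ρ / 2), ‖g z - f z‖ ≤ Λ * (s * ρ) := by
    intro z hz
    have hzK : z ∈ K := hsub z hz (Metric.mem_closedBall_self hsρ.le)
    have := φ.dist_normed_convolution_le (x₀ := z) (ε := Λ * (s * ρ)) hmeas ?_
    · rwa [indicator_of_mem hzK, dist_eq_norm] at this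
    intro w hw
    rw [indicator_of_mem hzK, indicator_of_mem (hsub z hz (Metric.ball_subset_closedBall hw)),
      dist_eq_norm]
    refine (hlip w (hsub' z hz hw) z (hsub' z hz (Metric.mem_ball_self hsρ))).trans ?_
    gcongr
    exact (mem_ball_iff_norm.1 hw).le
  have hder : ∀ z ∈ Metric.ball x (ρ / 2), ∃ f' : Eucl n →L[ℝ] F,
      HasFDerivAt g f' z ∧ ‖f' - A‖ ≤ η := by
    intro z hz
    obtain ⟨f', hf', hb⟩ := h.exists_hasFDerivAt_mollify hK hU φ (hsub z hz) A
    refine ⟨f', hf', hb.trans ?_⟩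
    have hGA : IntegrableOn (fun w => ‖G w - A‖) (Metric.ball x ρ) :=
      ((hGK.mono_set Metric.ball_subset_closedBall).sub
        (integrableOn_const measure_ball_lt_top.ne)).norm
    set V := volume.real (Metric.closedBall (0 : Eucl n) (s * ρ / 2)) with hV
    have hVpos : 0 < V :=
      ENNReal.toReal_pos (Metric.measure_closedBall_pos _ _ (by positivity)).ne'
        measure_closedBall_lt_top.ne
    have hVeq : volume.real (Metric.ball x ρ) * (s / 2) ^ n = V := by
      rw [hV, Measure.real, Measure.real, Measure.addHaar_closedBall _ _ (by positivity),
        Measure.addHaar_ball_of_pos _ _ hρ, finrank_euclideanSpace_fin, ENNReal.toReal_mul,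
        ENNReal.toReal_mul, ENNReal.toReal_ofReal (by positivity),
        ENNReal.toReal_ofReal (by positivity)]
      ring
    obtain ⟨C, hC⟩ := (hasCompactSupport_normed_sub φ z).exists_bound_of_continuous
      (contDiff_normed_sub φ z).continuous
    calc ∫ w in Metric.ball z φ.rOut, φ.normed volume (z - w) * ‖G w - A‖
        ≤ ∫ w in Metric.ball z φ.rOut, 1 / V * ‖G w - A‖ := by
          refine setIntegral_mono_on ?_ ((hGA.mono_set (hsub' z hz)).const_mul _)
            measurableSet_ball ?_
          · exact (hGA.mono_set (hsub' z hz)).bdd_mul (c := C)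
              (contDiff_normed_sub φ z).continuous.aestronglyMeasurable (Eventually.of_forall hC)
          · intro w _
            exact mul_le_mul_of_nonneg_right
              (φ.normed_le_div_measure_closedBall_rIn volume _) (norm_nonneg _)
      _ = 1 / V * ∫ w in Metric.ball z φ.rOut, ‖G w - A‖ := integral_const_mul _ _
      _ ≤ 1 / V * ∫ w in Metric.ball x ρ, ‖G w - A‖ := by
          refine mul_le_mul_of_nonneg_left ?_ (by positivity)
          exact setIntegral_mono_set hGA (Eventually.of_forall fun w => norm_nonneg _)
            (hsub' z hz).eventuallyLE
      _ ≤ 1 / V * (η * (s / 2) ^ n * volume.real (Metric.ball x ρ)) := by gcongr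
      _ = η := by
          rw [mul_assoc, mul_comm ((s / 2) ^ n), hVeq]
          field_simp
  choose! g' hg1 hg2 using hder
  have hx : x ∈ Metric.ball x (ρ / 2) := Metric.mem_ball_self (by positivity)
  have d3 : ‖g x' - g x - A (x' - x)‖ ≤ η * ‖x' - x‖ :=
    (convex_ball x (ρ / 2)).norm_image_sub_le_of_norm_hasFDerivWithin_le'
      (fun z hz => (hg1 z hz).hasFDerivWithinAt) hg2 hx hx'
  have d4 : η * ‖x' - x‖ ≤ η * (ρ / 2) := by
    gcongr
    exact (mem_ball_iff_norm.1 hx').le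
  have d1 := hclose x hx
  have d2 := hclose x' hx'
  calc ‖f x' - f x - A (x' - x)‖
      = ‖(g x' - g x - A (x' - x)) + (g x - f x) - (g x' - f x')‖ := by congr 1; abel
    _ ≤ ‖g x' - g x - A (x' - x)‖ + ‖g x - f x‖ + ‖g x' - f x'‖ :=
      (_root_.norm_sub_le _ _).trans (add_le_add_left (norm_add_le _ _) _)
    _ ≤ η * ρ := by nlinarith

/-- Near a point of `U`, a VMO immersion is at every small scale uniformly close to an affine map
whose linear part `A` is the mean of `G`; `A` satisfies bounds independent of the scale. -/
lemma IsVMOImmersionOn.exists_approx (h : IsVMOImmersionOn U f G lam Lam) {x₀ : Eucl n}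
    (hx₀ : x₀ ∈ U) :
    ∃ δ > 0, Metric.ball x₀ δ ⊆ U ∧ ∀ η > 0, ∃ ρ₀ > 0, ∀ x ∈ Metric.ball x₀ δ,
      ∀ ρ, 0 < ρ → ρ < ρ₀ → Metric.ball x ρ ⊆ U ∧ ∃ A : Eucl n →L[ℝ] F,
        (∀ v, lam / 2 * ‖v‖ ≤ ‖A v‖) ∧ ‖A‖ ≤ Lam + lam ∧
        AEMeasurable (fun z => ‖G z - A‖ₑ) (volume.restrict (Metric.ball x ρ)) ∧
        (∀ x' ∈ Metric.ball x ρ, ‖f x' - f x - A (x' - x)‖ ≤ η * ρ) ∧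
        ∫⁻ z in Metric.ball x ρ, ‖G z - A‖ₑ ≤ ENNReal.ofReal η * volume (Metric.ball x ρ) := by
  obtain ⟨R, hR, hRU⟩ := Metric.nhds_basis_closedBall.mem_iff.1 (h.isOpen.mem_nhds hx₀)
  have hlip : ∀ y ∈ Metric.ball x₀ (R / 2), ∀ z ∈ Metric.ball x₀ (R / 2),
      ‖f y - f z‖ ≤ Lam * ‖y - z‖ := fun y hy z hz =>
    h.hasWeakFDerivOn.norm_sub_le h.continuousOn (by linarith) hRU h.norm_le hz hy
  refine ⟨R / 4, by positivity, (Metric.ball_subset_closedBall.trans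
    (Metric.closedBall_subset_closedBall (by linarith))).trans hRU, fun η hη => ?_⟩
  obtain ⟨ε₁, hε₁, happ⟩ := exists_affine_approx (F := F) n h.Lam_nonneg (half_pos hη)
  obtain ⟨ε, hε, hε1, hε2, hε3⟩ : ∃ ε : ℝ, 0 < ε ∧ ε ≤ ε₁ ∧ ε ≤ lam / 2 ∧ ε * 2 ^ n ≤ η := by
    have := h.lam_pos
    refine ⟨min ε₁ (min (lam / 2) (η / 2 ^ n)), by positivity, min_le_left _ _,
      (min_le_right _ _).trans (min_le_left _ _), ?_⟩
    rw [← le_div_iff₀ (by positivity)]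
    exact (min_le_right _ _).trans (min_le_right _ _)
  have hosc : ∀ᶠ r in 𝓝[>] (0 : ℝ), oscModulus U G r < ENNReal.ofReal ε :=
    h.tendsto_oscModulus.eventually_lt_const (ENNReal.ofReal_pos.2 hε)
  obtain ⟨r₀, hr₀, hosc⟩ := mem_nhdsGT_iff_exists_Ioo_subset.1 hosc
  refine ⟨min (r₀ / 2) (R / 8), lt_min (half_pos hr₀) (by positivity), fun x hx ρ hρ hρ₀ => ?_⟩
  have hρ1 : 2 * ρ < r₀ := by linarith [hρ₀.trans_le (min_le_left _ _)]
  have hρ2 : 2 * ρ < R / 4 := by linarith [hρ₀.trans_le (min_le_right _ _)]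
  have hxd := Metric.mem_ball.1 hx
  have hcl : Metric.closedBall x (2 * ρ) ⊆ Metric.ball x₀ (R / 2) :=
    Metric.closedBall_subset_ball' (by linarith)
  have hclU : Metric.closedBall x (2 * ρ) ⊆ U :=
    (hcl.trans (Metric.ball_subset_ball (by linarith))).trans
      (Metric.ball_subset_closedBall.trans hRU)
  have hB2 : Metric.ball x (2 * ρ) ⊆ U := Metric.ball_subset_closedBall.trans hclU
  have hB1 : Metric.ball x ρ ⊆ Metric.ball x (2 * ρ) := Metric.ball_subset_ball (by linarith)
  refine ⟨hB1.trans hB2, ⨍ z in Metric.ball x (2 * ρ), G z, ?_⟩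
  set A := ⨍ z in Metric.ball x (2 * ρ), G z with hA
  have hGint : IntegrableOn G (Metric.ball x (2 * ρ)) :=
    (h.hasWeakFDerivOn.locallyIntegrableOn_deriv.integrableOn_compact_subset hclU
      (isCompact_closedBall _ _)).mono_set Metric.ball_subset_closedBall
  have hGA : IntegrableOn (fun z => G z - A) (Metric.ball x (2 * ρ)) :=
    hGint.sub (integrableOn_const measure_ball_lt_top.ne)
  have hvol0 : volume (Metric.ball x (2 * ρ)) ≠ 0 :=
    (Metric.measure_ball_pos _ _ (by positivity)).ne'
  have hvolt : volume (Metric.ball x (2 * ρ)) ≠ ⊤ := measure_ball_lt_top.ne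
  have havg : ⨍⁻ z in Metric.ball x (2 * ρ), ‖G z - A‖ₑ ∂volume ≤ ENNReal.ofReal ε := by
    refine le_trans ?_ (hosc ⟨by positivity, hρ1⟩ : oscModulus U G (2 * ρ) < _).le
    unfold oscModulus
    exact le_iSup_of_le x (le_iSup_of_le (2 * ρ)
      (le_iSup_of_le ⟨by positivity, le_rfl, hB2⟩ le_rfl))
  have hlint : ∫⁻ z in Metric.ball x (2 * ρ), ‖G z - A‖ₑ
      ≤ ENNReal.ofReal ε * volume (Metric.ball x (2 * ρ)) := by
    rw [setLAverage_eq] at havg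
    exact (ENNReal.div_le_iff hvol0 hvolt).1 havg
  -- a point where `G` is within `ε` of its mean and the pointwise bounds hold
  obtain ⟨z, hz1, hz2, hz3⟩ : ∃ z, (∀ v, lam * ‖v‖ ≤ ‖G z v‖) ∧ ‖G z‖ ≤ Lam ∧ ‖G z - A‖ ≤ ε := by
    have hae : ∀ᵐ z ∂(volume.restrict (Metric.ball x (2 * ρ))),
        (∀ v, lam * ‖v‖ ≤ ‖G z v‖) ∧ ‖G z‖ ≤ Lam := by
      filter_upwards [ae_restrict_of_ae h.bounds, ae_restrict_of_ae h.norm_le,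
        ae_restrict_mem measurableSet_ball] with z h1 h2 h3
      exact ⟨fun v => (h1 (hB2 h3) v).1, h2 (hB2 h3)⟩
    have : IsFiniteMeasure (volume.restrict (Metric.ball x (2 * ρ))) :=
      ⟨by rw [Measure.restrict_apply_univ]; exact measure_ball_lt_top⟩
    obtain ⟨z, hzN, hz⟩ := exists_notMem_null_le_laverage
      (μ := volume.restrict (Metric.ball x (2 * ρ))) (f := fun z => ‖G z - A‖ₑ)
      (by rwa [Ne, Measure.restrict_eq_zero]) hGA.aestronglyMeasurable.enorm (ae_iff.1 hae)
    have hz' := not_not.1 hzN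
    refine ⟨z, hz'.1, hz'.2, ?_⟩
    have := hz.trans havg
    rwa [← ofReal_norm, ENNReal.ofReal_le_ofReal_iff hε.le] at this
  refine ⟨fun v => ?_, ?_, (hGA.mono_set hB1).aestronglyMeasurable.enorm, ?_, ?_⟩
  · have h1 : ‖G z v‖ - ‖A v‖ ≤ ‖(G z - A) v‖ := by
      simpa using norm_sub_norm_le (G z v) (A v)
    have h2 := (G z - A).le_of_opNorm_le hz3 v
    have h3 := hz1 v
    nlinarith [norm_nonneg v]
  · have h1 : ‖A‖ - ‖G z‖ ≤ ‖G z - A‖ := by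
      rw [norm_sub_rev]; exact norm_sub_norm_le _ _
    have := h.lam_pos
    linarith
  · intro x' hx'
    have := happ h.hasWeakFDerivOn (by positivity : 0 < 2 * ρ) hclU
      (fun y hy z hz => hlip y (hcl (Metric.ball_subset_closedBall hy)) z
        (hcl (Metric.ball_subset_closedBall hz))) (A := A) ?_ x' (by simpa using hx')
    · linarith
    · rw [integral_norm_eq_lintegral_enorm hGA.aestronglyMeasurable]
      refine ENNReal.toReal_le_of_le_ofReal (by positivity) (hlint.trans ?_)
      rw [ENNReal.ofReal_mul hε₁.le, Measure.real, ENNReal.ofReal_toReal hvolt]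
      gcongr
  · refine (lintegral_mono_set hB1).trans (hlint.trans ?_)
    rw [Measure.addHaar_ball_of_pos _ _ hρ, Measure.addHaar_ball_of_pos _ _ (by positivity),
      ← mul_assoc, ← mul_assoc, ← ENNReal.ofReal_mul hε.le, ← ENNReal.ofReal_mul hη.le,
      finrank_euclideanSpace_fin, mul_pow]
    refine mul_le_mul' (ENNReal.ofReal_le_ofReal ?_) le_rfl
    calc ε * (2 ^ n * ρ ^ n) = (ε * 2 ^ n) * ρ ^ n := by ring
      _ ≤ η * ρ ^ n := by gcongr

/-- A VMO immersion expands distances locally; in particular it is locally injective. -/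
lemma IsVMOImmersionOn.exists_antilipschitz (h : IsVMOImmersionOn U f G lam Lam) {x₀ : Eucl n}
    (hx₀ : x₀ ∈ U) :
    ∃ δ > 0, Metric.ball x₀ δ ⊆ U ∧ ∀ x ∈ Metric.ball x₀ δ, ∀ x' ∈ Metric.ball x₀ δ,
      lam / 4 * ‖x' - x‖ ≤ ‖f x' - f x‖ := by
  obtain ⟨δ, hδ, hδU, happ⟩ := h.exists_approx hx₀
  have hlam := h.lam_pos
  obtain ⟨ρ₀, hρ₀, happ⟩ := happ (lam / 8) (by positivity)
  refine ⟨min δ (ρ₀ / 4), by positivity,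
    (Metric.ball_subset_ball (min_le_left _ _)).trans hδU, fun x hx x' hx' => ?_⟩
  rcases eq_or_ne x' x with rfl | hne
  · simp
  have hpos : 0 < ‖x' - x‖ := norm_pos_iff.2 (sub_ne_zero.2 hne)
  have hlt : ‖x' - x‖ < ρ₀ / 2 := by
    rw [← dist_eq_norm]
    have h1 := Metric.mem_ball.1 (Metric.ball_subset_ball (min_le_right _ _) hx)
    have h2 := Metric.mem_ball.1 (Metric.ball_subset_ball (min_le_right _ _) hx')
    linarith [dist_triangle_right x' x x₀]
  -- the affine approximation on the ball of twice the distance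
  obtain ⟨-, A, hA, -, -, hapx, -⟩ := happ x (Metric.ball_subset_ball (min_le_left _ _) hx)
    (2 * ‖x' - x‖) (by positivity) (by linarith)
  have h1 := hapx x' (by rw [mem_ball_iff_norm]; linarith)
  have h2 := hA (x' - x)
  have h3 : ‖A (x' - x)‖ - ‖f x' - f x‖ ≤ ‖f x' - f x - A (x' - x)‖ := by
    rw [norm_sub_rev (f x' - f x)]; exact norm_sub_norm_le _ _
  linarith

end Affine

/-! ### The Jacobian of a linear map into an inner product space -/

section Jacobian

variable {n : ℕ} {F : Type*} [NormedAddCommGroup F] [InnerProductSpace ℝ F]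

/-- The Gram matrix `⟨A eᵢ, A eⱼ⟩` of the images of the standard basis vectors. -/
noncomputable def gram (A : Eucl n →L[ℝ] F) : Matrix (Fin n) (Fin n) ℝ :=
  Matrix.of fun i j => inner ℝ (A (EuclideanSpace.basisFun (Fin n) ℝ i))
    (A (EuclideanSpace.basisFun (Fin n) ℝ j))

/-- The Jacobian `√det(Aᵀ A)`, the factor by which `A` scales `n`-dimensional volume. -/
noncomputable def jacobian (A : Eucl n →L[ℝ] F) : ℝ := Real.sqrt (gram A).det

lemma jacobian_nonneg (A : Eucl n →L[ℝ] F) : 0 ≤ jacobian A := Real.sqrt_nonneg _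

lemma gram_comp (A : Eucl n →L[ℝ] F) (T : Eucl n →L[ℝ] Eucl n) :
    gram (A.comp T) = (LinearMap.toMatrix (EuclideanSpace.basisFun (Fin n) ℝ).toBasis
      (EuclideanSpace.basisFun (Fin n) ℝ).toBasis (T : Eucl n →ₗ[ℝ] Eucl n)).transpose * gram A *
      LinearMap.toMatrix (EuclideanSpace.basisFun (Fin n) ℝ).toBasis
      (EuclideanSpace.basisFun (Fin n) ℝ).toBasis (T : Eucl n →ₗ[ℝ] Eucl n) := by
  ext i j
  have hT : ∀ i, A (T (EuclideanSpace.basisFun (Fin n) ℝ i)) =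
      ∑ k, (T (EuclideanSpace.basisFun (Fin n) ℝ i)) k •
        A (EuclideanSpace.basisFun (Fin n) ℝ k) := by
    intro i
    conv_lhs => rw [← (EuclideanSpace.basisFun (Fin n) ℝ).sum_repr
      (T (EuclideanSpace.basisFun (Fin n) ℝ i))]
    simp only [map_sum, map_smul, EuclideanSpace.basisFun_repr]
  simp only [gram, Matrix.of_apply, ContinuousLinearMap.comp_apply, hT, Matrix.mul_apply,
    Matrix.transpose_apply, LinearMap.toMatrix_apply, sum_inner, inner_sum, inner_smul_left,
    inner_smul_right, Finset.sum_mul, Finset.mul_sum]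
  refine Finset.sum_congr rfl fun k _ => Finset.sum_congr rfl fun l _ => ?_
  simp
  ring

lemma jacobian_comp (A : Eucl n →L[ℝ] F) (T : Eucl n →L[ℝ] Eucl n) :
    jacobian (A.comp T) = |T.det| * jacobian A := by
  rw [jacobian, gram_comp, Matrix.det_mul, Matrix.det_mul, Matrix.det_transpose,
    LinearMap.det_toMatrix, mul_right_comm, Real.sqrt_mul (mul_self_nonneg _),
    Real.sqrt_mul_self_eq_abs]
  rfl

lemma jacobian_linearIsometry (L : Eucl n →ₗᵢ[ℝ] F) :
    jacobian L.toContinuousLinearMap = 1 := by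
  have : gram L.toContinuousLinearMap = 1 := by
    ext i j
    simp only [gram, Matrix.of_apply, LinearIsometry.coe_toContinuousLinearMap,
      LinearIsometry.inner_map_map, Matrix.one_apply]
    exact orthonormal_iff_ite.1 (EuclideanSpace.basisFun (Fin n) ℝ).orthonormal i j
  rw [jacobian, this, Matrix.det_one, Real.sqrt_one]

lemma continuous_jacobian : Continuous (jacobian : (Eucl n →L[ℝ] F) → ℝ) := by
  refine Real.continuous_sqrt.comp (Continuous.matrix_det ?_)
  refine continuous_matrix fun i j => ?_
  simp only [gram, Matrix.of_apply]
  fun_prop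

/-- An injective linear map factors as an isometric embedding after an endomorphism. -/
lemma exists_eq_linearIsometry_comp (A : Eucl n →L[ℝ] F) (hA : Function.Injective A) :
    ∃ (L : Eucl n →ₗᵢ[ℝ] F) (T : Eucl n →L[ℝ] Eucl n), A = L.toContinuousLinearMap.comp T := by
  set V := LinearMap.range (A : Eucl n →ₗ[ℝ] F) with hV
  have hrank : Module.finrank ℝ V = n := by
    rw [hV, LinearMap.finrank_range_of_inj hA, finrank_euclideanSpace_fin]
  set e : V ≃ₗᵢ[ℝ] Eucl n := ((stdOrthonormalBasis ℝ V).reindex (finCongr hrank)).repr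
  refine ⟨V.subtypeₗᵢ.comp e.symm.toLinearIsometry,
    LinearMap.toContinuousLinearMap
      (e.toLinearEquiv.toLinearMap ∘ₗ (A : Eucl n →ₗ[ℝ] F).rangeRestrict), ?_⟩
  ext v
  simp

/-- The ellipsoid `{‖A (x - x₀)‖ < s}`, measured with weight `jacobian A`, has the volume of a
Euclidean ball of radius `s`. -/
lemma jacobian_mul_volume_ellipsoid (A : Eucl n →L[ℝ] F) (hA : Function.Injective A)
    (x₀ : Eucl n) {s : ℝ} (hs : 0 < s) :
    ENNReal.ofReal (jacobian A) * volume {x | ‖A (x - x₀)‖ < s} =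
      ENNReal.ofReal (s ^ n) * volume (Metric.ball (0 : Eucl n) 1) := by
  obtain ⟨L, T, rfl⟩ := exists_eq_linearIsometry_comp A hA
  have hTinj : Function.Injective (T : Eucl n →ₗ[ℝ] Eucl n) := by
    intro x y hxy
    apply hA
    exact congrArg L hxy
  have hdet : LinearMap.det (T : Eucl n →ₗ[ℝ] Eucl n) ≠ 0 := by
    have := LinearMap.isUnit_iff_ker_eq_bot (T : Eucl n →ₗ[ℝ] Eucl n) |>.2
      (LinearMap.ker_eq_bot.2 hTinj)
    exact ((LinearMap.isUnit_iff_isUnit_det _).1 this).ne_zero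
  have hset : {x | ‖(L.toContinuousLinearMap.comp T) (x - x₀)‖ < s} =
      (fun x => x + (-x₀)) ⁻¹' ((T : Eucl n →ₗ[ℝ] Eucl n) ⁻¹' Metric.ball 0 s) := by
    ext x
    simp only [mem_ofPred_eq, mem_preimage, mem_ball_zero_iff, ← sub_eq_add_neg,
      ContinuousLinearMap.comp_apply, LinearIsometry.coe_toContinuousLinearMap,
      LinearIsometry.norm_map]
    rfl
  rw [hset, measure_preimage_add_right, Measure.addHaar_preimage_linearMap _ hdet,
    jacobian_comp, jacobian_linearIsometry, mul_one, ← mul_assoc,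
    ← ENNReal.ofReal_mul (abs_nonneg _), abs_inv]
  have : T.det = LinearMap.det (T : Eucl n →ₗ[ℝ] Eucl n) := rfl
  rw [this, mul_inv_cancel₀ (abs_ne_zero.2 hdet), ENNReal.ofReal_one, one_mul,
    Measure.addHaar_ball_of_pos _ _ hs, finrank_euclideanSpace_fin]

/-- A linear lower bound for `A` bounds its Jacobian from below: the ellipsoid `{‖A x‖ < 1}` is
contained in a ball of radius `c⁻¹`. -/
lemma pow_le_jacobian (A : Eucl n →L[ℝ] F) {c : ℝ} (hc : 0 < c) (hA : ∀ v, c * ‖v‖ ≤ ‖A v‖) :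
    c ^ n ≤ jacobian A := by
  have hinj : Function.Injective A := by
    refine (injective_iff_map_eq_zero A).2 fun v hv => ?_
    have := hA v
    rw [hv, norm_zero] at this
    have : ‖v‖ ≤ 0 := by nlinarith
    exact norm_le_zero_iff.1 this
  have h1 := jacobian_mul_volume_ellipsoid A hinj 0 one_pos
  have hsub : {x | ‖A (x - 0)‖ < 1} ⊆ Metric.ball 0 c⁻¹ := by
    intro x hx
    have hx : ‖A (x - 0)‖ < 1 := hx
    rw [sub_zero] at hx
    rw [mem_ball_zero_iff, ← one_div, lt_div_iff₀' hc]
    exact (hA x).trans_lt hx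
  have h2 := mul_le_mul' (le_refl (ENNReal.ofReal (jacobian A))) (measure_mono (μ := volume) hsub)
  rw [h1, Measure.addHaar_ball_of_pos _ _ (inv_pos.2 hc), finrank_euclideanSpace_fin, one_pow,
    ← mul_assoc, ENNReal.mul_le_mul_iff_left
      (Metric.measure_ball_pos volume (0 : Eucl n) one_pos).ne' measure_ball_lt_top.ne,
    ← ENNReal.ofReal_mul (jacobian_nonneg A),
    ENNReal.ofReal_le_ofReal_iff (by have := jacobian_nonneg A; positivity), inv_pow,
    ← div_eq_mul_inv, one_le_div (by positivity)] at h2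
  exact h2

/-- A continuous function on a compact set is Lipschitz up to an arbitrarily small error. -/
lemma exists_abs_sub_le_add_mul {X : Type*} [PseudoMetricSpace X] {S : Set X} (hS : IsCompact S)
    {φ : X → ℝ} (hφ : Continuous φ) {η : ℝ} (hη : 0 < η) :
    ∃ C, 0 ≤ C ∧ ∀ a ∈ S, ∀ b ∈ S, |φ a - φ b| ≤ η + C * dist a b := by
  obtain ⟨b, hb⟩ := hS.exists_bound_of_continuousOn hφ.continuousOn
  have hu := Metric.uniformContinuousOn_iff_le.1
    (hS.uniformContinuousOn_of_continuous hφ.continuousOn) η hη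
  obtain ⟨δ, hδ, hu⟩ := hu
  refine ⟨2 * |b| / δ, by positivity, fun a ha c hc => ?_⟩
  rcases le_or_gt (dist a c) δ with h | h
  · have := hu a ha c hc h
    rw [Real.dist_eq] at this
    have h0 : 0 ≤ 2 * |b| / δ * dist a c := by positivity
    linarith
  · have h1 : |φ a - φ c| ≤ 2 * |b| := by
      have h2 := (hb a ha).trans (le_abs_self b)
      have h3 := (hb c hc).trans (le_abs_self b)
      rw [Real.norm_eq_abs] at h2 h3
      linarith [abs_sub (φ a) (φ c)]
    have h2 : 2 * |b| ≤ 2 * |b| / δ * dist a c := by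
      rw [div_mul_eq_mul_div, le_div_iff₀ hδ]
      gcongr
    linarith

end Jacobian

/-! ### Density of a VMO immersion at a point of the domain -/

section Density

variable {n : ℕ} {F : Type*} [NormedAddCommGroup F] [InnerProductSpace ℝ F]
  [FiniteDimensional ℝ F]
  {U : Set (Eucl n)} {f : Eucl n → F} {G : Eucl n → (Eucl n →L[ℝ] F)} {lam Lam : ℝ}

/-- Two-sided bounds, at small scales and up to an error `η`, for the volume of the part of the
preimage of a small ball which lies in `W`. With `c = 8 / lam`, the preimage of a ball of radius
`r` lies in the ball of radius `c r` and between two ellipsoids of sizes `r (1 ± η c)`. -/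
lemma IsVMOImmersionOn.eventually_volume_bounds (h : IsVMOImmersionOn U f G lam Lam)
    {x₀ : Eucl n} {W : Set (Eucl n)} (hW : IsOpen W) (hx₀ : x₀ ∈ W) (hWU : W ⊆ U)
    (hanti : ∀ x ∈ W, lam / 4 * ‖x - x₀‖ ≤ ‖f x - f x₀‖) {η : ℝ} (hη : 0 < η)
    (hηc : η * (8 / lam) < 1) :
    ∀ᶠ r in 𝓝[>] (0 : ℝ),
      ENNReal.ofReal ((1 - η * (8 / lam)) ^ n - 2 * η * (8 / lam) ^ n) *
          (ENNReal.ofReal (r ^ n) * volume (Metric.ball (0 : Eucl n) 1)) ≤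
        ∫⁻ x in W ∩ f ⁻¹' Metric.ball (f x₀) r, ENNReal.ofReal (jacobian (G x)) ∧
      ∫⁻ x in W ∩ f ⁻¹' Metric.ball (f x₀) r, ENNReal.ofReal (jacobian (G x)) ≤
        ENNReal.ofReal ((1 + η * (8 / lam)) ^ n + 2 * η * (8 / lam) ^ n) *
          (ENNReal.ofReal (r ^ n) * volume (Metric.ball (0 : Eucl n) 1)) := by
  have hlam := h.lam_pos
  set c := 8 / lam with hc
  have hc0 : 0 < c := by positivity
  have hclam : c * lam = 8 := by rw [hc]; field_simp
  obtain ⟨δ, hδ, hδU, happ⟩ := h.exists_approx (hWU hx₀)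
  obtain ⟨C, hC, hJ⟩ := exists_abs_sub_le_add_mul
    (isCompact_closedBall (0 : Eucl n →L[ℝ] F) (Lam + lam)) continuous_jacobian hη
  obtain ⟨η', hη', hηη', hCη⟩ : ∃ η' : ℝ, 0 < η' ∧ η' ≤ η ∧ C * η' ≤ η := by
    refine ⟨min η (η / (C + 1)), by positivity, min_le_left _ _, ?_⟩
    calc C * min η (η / (C + 1)) ≤ (C + 1) * (η / (C + 1)) := by
          gcongr
          · linarith
          · exact min_le_right _ _
      _ = η := by field_simp
  obtain ⟨ρ₀, hρ₀, happ⟩ := happ η' hη'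
  obtain ⟨ρ₁, hρ₁, hρ₁W⟩ := Metric.isOpen_iff.1 hW x₀ hx₀
  have hev : ∀ᶠ r in 𝓝[>] (0 : ℝ), r < min ρ₀ ρ₁ / c :=
    (eventually_lt_nhds (by positivity)).filter_mono nhdsWithin_le_nhds
  filter_upwards [hev, self_mem_nhdsWithin] with r hr hr0
  have hr0 : 0 < r := hr0
  rw [lt_div_iff₀ hc0, mul_comm] at hr
  have hcr : 0 < c * r := by positivity
  obtain ⟨hBU, A, hAlow, hAup, hGm, hAff, hGA⟩ := happ x₀ (Metric.mem_ball_self hδ) (c * r) hcr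
    (hr.trans_le (min_le_left _ _))
  set B := Metric.ball x₀ (c * r) with hB
  set P := W ∩ f ⁻¹' Metric.ball (f x₀) r with hP
  set κ := volume (Metric.ball (0 : Eucl n) 1) with hκ
  have hBW : B ⊆ W := (Metric.ball_subset_ball (hr.le.trans (min_le_right _ _))).trans hρ₁W
  have hPopen : IsOpen P :=
    (h.continuousOn.mono hWU).isOpen_inter_preimage hW Metric.isOpen_ball
  have hAinj : Function.Injective A := by
    refine (injective_iff_map_eq_zero A).2 fun v hv => ?_
    have := hAlow v
    rw [hv, norm_zero] at this
    have : ‖v‖ ≤ 0 := by nlinarith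
    exact norm_le_zero_iff.1 this
  -- the error in replacing the Jacobian of `G` by that of `A`
  set err : Eucl n → ℝ≥0∞ := fun x => ENNReal.ofReal η + ENNReal.ofReal C * ‖G x - A‖ₑ with herr
  have herrm : AEMeasurable err (volume.restrict B) := (hGm.const_mul _).const_add _
  have herrint : ∫⁻ x in B, err x ≤ ENNReal.ofReal (2 * η * c ^ n) * (ENNReal.ofReal (r ^ n) * κ) := by
    rw [herr, lintegral_add_left measurable_const, setLIntegral_const,
      lintegral_const_mul' _ _ ENNReal.ofReal_ne_top]
    calc ENNReal.ofReal η * volume B + ENNReal.ofReal C * ∫⁻ x in B, ‖G x - A‖ₑ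
        ≤ ENNReal.ofReal η * volume B
          + ENNReal.ofReal C * (ENNReal.ofReal η' * volume B) := by gcongr
      _ ≤ ENNReal.ofReal η * volume B + ENNReal.ofReal η * volume B := by
          rw [← mul_assoc, ← ENNReal.ofReal_mul hC]
          gcongr
      _ = _ := by
          rw [hB, Measure.addHaar_ball_of_pos _ _ hcr, finrank_euclideanSpace_fin, ← two_mul,
            mul_pow, ENNReal.ofReal_mul (by positivity), ENNReal.ofReal_mul (by positivity),
            ENNReal.ofReal_mul (by positivity), ENNReal.ofReal_ofNat]
          ring
  have hae : ∀ᵐ x, x ∈ B →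
      ENNReal.ofReal (jacobian (G x)) ≤ ENNReal.ofReal (jacobian A) + err x ∧
      ENNReal.ofReal (jacobian A) ≤ ENNReal.ofReal (jacobian (G x)) + err x := by
    filter_upwards [h.norm_le] with x hx hxB
    have hGx : G x ∈ Metric.closedBall (0 : Eucl n →L[ℝ] F) (Lam + lam) := by
      rw [mem_closedBall_zero_iff]
      linarith [hx (hBU hxB)]
    have hAx : A ∈ Metric.closedBall (0 : Eucl n →L[ℝ] F) (Lam + lam) :=
      mem_closedBall_zero_iff.2 hAup
    have h1 := abs_le.1 (hJ _ hGx _ hAx)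
    have h2 : err x = ENNReal.ofReal (η + C * dist (G x) A) := by
      rw [ENNReal.ofReal_add hη.le (by positivity), ENNReal.ofReal_mul hC, dist_eq_norm,
        ofReal_norm]
    rw [h2, ← ENNReal.ofReal_add (jacobian_nonneg _) (by positivity),
      ← ENNReal.ofReal_add (jacobian_nonneg _) (by positivity)]
    exact ⟨ENNReal.ofReal_le_ofReal (by linarith), ENNReal.ofReal_le_ofReal (by linarith)⟩
  have haff : ∀ x ∈ B, |‖f x - f x₀‖ - ‖A (x - x₀)‖| ≤ η * c * r := by
    intro x hx
    refine (abs_norm_sub_norm_le _ _).trans ((hAff x hx).trans ?_)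
    rw [mul_assoc]
    gcongr
  have hPB : P ⊆ B := by
    intro x hx
    have h1 := hanti x hx.1
    have h2 : ‖f x - f x₀‖ < r := mem_ball_iff_norm.1 hx.2
    rw [hB, mem_ball_iff_norm]
    have h3 : lam * ‖x - x₀‖ < lam * (c * r) := by nlinarith
    exact lt_of_mul_lt_mul_left h3 hlam.le
  have hPE : P ⊆ {x | ‖A (x - x₀)‖ < r * (1 + η * c)} := by
    intro x hx
    have h1 := abs_le.1 (haff x (hPB hx))
    have h2 : ‖f x - f x₀‖ < r := mem_ball_iff_norm.1 hx.2
    rw [mem_ofPred_eq]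
    nlinarith
  set E := {x | ‖A (x - x₀)‖ < r * (1 - η * c)} with hE
  have hEopen : IsOpen E := isOpen_lt (by fun_prop) continuous_const
  have hEB : E ⊆ B := by
    intro x hx
    have h1 := hAlow (x - x₀)
    have h2 : ‖A (x - x₀)‖ < r * (1 - η * c) := hx
    have h4 : 0 < r * (η * c) := by positivity
    rw [hB, mem_ball_iff_norm]
    have h3 : lam * ‖x - x₀‖ < lam * (c * r) := by nlinarith
    exact lt_of_mul_lt_mul_left h3 hlam.le
  have hEP : E ⊆ P := by
    intro x hx
    have h1 := abs_le.1 (haff x (hEB hx))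
    have h2 : ‖A (x - x₀)‖ < r * (1 - η * c) := hx
    refine ⟨hBW (hEB hx), mem_ball_iff_norm.2 ?_⟩
    nlinarith
  constructor
  · have hlow : ENNReal.ofReal ((1 - η * c) ^ n) * (ENNReal.ofReal (r ^ n) * κ) ≤
        (∫⁻ x in P, ENNReal.ofReal (jacobian (G x))) +
          ENNReal.ofReal (2 * η * c ^ n) * (ENNReal.ofReal (r ^ n) * κ) := by
      calc ENNReal.ofReal ((1 - η * c) ^ n) * (ENNReal.ofReal (r ^ n) * κ)
          = ENNReal.ofReal (jacobian A) * volume E := by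
            rw [hE, jacobian_mul_volume_ellipsoid A hAinj x₀ (by nlinarith), mul_pow,
              ENNReal.ofReal_mul (by positivity)]
            ring
        _ = ∫⁻ x in E, ENNReal.ofReal (jacobian A) := (setLIntegral_const _ _).symm
        _ ≤ ∫⁻ x in E, (ENNReal.ofReal (jacobian (G x)) + err x) := by
            refine lintegral_mono_ae ?_
            filter_upwards [ae_restrict_of_ae hae, ae_restrict_mem hEopen.measurableSet]
              with x hx hxE
            exact (hx (hEB hxE)).2
        _ = (∫⁻ x in E, ENNReal.ofReal (jacobian (G x))) + ∫⁻ x in E, err x :=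
            lintegral_add_right' _ (herrm.mono_measure (Measure.restrict_mono hEB le_rfl))
        _ ≤ _ := add_le_add (lintegral_mono_set hEP) ((lintegral_mono_set hEB).trans herrint)
    rw [ENNReal.ofReal_sub _ (by positivity), ENNReal.sub_mul]
    · exact tsub_le_iff_right.2 hlow
    · intro _ _
      exact ENNReal.mul_ne_top ENNReal.ofReal_ne_top measure_ball_lt_top.ne
  · calc ∫⁻ x in P, ENNReal.ofReal (jacobian (G x))
        ≤ ∫⁻ x in P, (ENNReal.ofReal (jacobian A) + err x) := by
          refine lintegral_mono_ae ?_
          filter_upwards [ae_restrict_of_ae hae, ae_restrict_mem hPopen.measurableSet]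
            with x hx hxP
          exact (hx (hPB hxP)).1
      _ = ENNReal.ofReal (jacobian A) * volume P + ∫⁻ x in P, err x := by
          rw [lintegral_add_left measurable_const, setLIntegral_const]
      _ ≤ ENNReal.ofReal (jacobian A) * volume {x | ‖A (x - x₀)‖ < r * (1 + η * c)} +
          ENNReal.ofReal (2 * η * c ^ n) * (ENNReal.ofReal (r ^ n) * κ) :=
          add_le_add (mul_le_mul' le_rfl (measure_mono hPE))
            ((lintegral_mono_set hPB).trans herrint)
      _ = _ := by
          rw [jacobian_mul_volume_ellipsoid A hAinj x₀ (by positivity), mul_pow,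
            ENNReal.ofReal_mul (by positivity), ENNReal.ofReal_add (by positivity)
            (by positivity)]
          ring

/-- A VMO immersion has density one at each point of its domain. -/
lemma IsVMOImmersionOn.tendsto_density (h : IsVMOImmersionOn U f G lam Lam)
    {x₀ : Eucl n} {W : Set (Eucl n)} (hW : IsOpen W) (hx₀ : x₀ ∈ W) (hWU : W ⊆ U)
    (hanti : ∀ x ∈ W, lam / 4 * ‖x - x₀‖ ≤ ‖f x - f x₀‖) :
    Tendsto (fun r : ℝ => (∫⁻ x in W ∩ f ⁻¹' Metric.ball (f x₀) r,
        ENNReal.ofReal (jacobian (G x))) /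
        (ENNReal.ofReal (r ^ n) * volume (Metric.ball (0 : Eucl n) 1))) (𝓝[>] 0) (𝓝 1) := by
  have hlam := h.lam_pos
  set c := 8 / lam with hc
  have hc0 : 0 < c := by positivity
  have hsmall : ∀ᶠ η in 𝓝[>] (0 : ℝ), 0 < η ∧ η * c < 1 := by
    have h1 : ∀ᶠ η in 𝓝[>] (0 : ℝ), η < 1 / c :=
      (eventually_lt_nhds (by positivity)).filter_mono nhdsWithin_le_nhds
    filter_upwards [h1, self_mem_nhdsWithin] with η h1 h2
    exact ⟨h2, (lt_div_iff₀ hc0).1 h1⟩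
  have hl : Tendsto (fun η : ℝ => ENNReal.ofReal ((1 - η * c) ^ n - 2 * η * c ^ n))
      (𝓝[>] 0) (𝓝 1) := by
    have : Continuous fun η : ℝ => ENNReal.ofReal ((1 - η * c) ^ n - 2 * η * c ^ n) :=
      ENNReal.continuous_ofReal.comp (by fun_prop)
    simpa using (this.tendsto 0).mono_left nhdsWithin_le_nhds
  have hu : Tendsto (fun η : ℝ => ENNReal.ofReal ((1 + η * c) ^ n + 2 * η * c ^ n))
      (𝓝[>] 0) (𝓝 1) := by
    have : Continuous fun η : ℝ => ENNReal.ofReal ((1 + η * c) ^ n + 2 * η * c ^ n) :=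
      ENNReal.continuous_ofReal.comp (by fun_prop)
    simpa using (this.tendsto 0).mono_left nhdsWithin_le_nhds
  have hκ0 : volume (Metric.ball (0 : Eucl n) 1) ≠ 0 :=
    (Metric.measure_ball_pos _ _ one_pos).ne'
  have hκt : volume (Metric.ball (0 : Eucl n) 1) ≠ ⊤ := measure_ball_lt_top.ne
  refine tendsto_order.2 ⟨fun a ha => ?_, fun a ha => ?_⟩
  · obtain ⟨η, hη, h1, h2⟩ := ((hl.eventually_const_lt ha).and hsmall).exists
    filter_upwards [h.eventually_volume_bounds hW hx₀ hWU hanti h1 h2, self_mem_nhdsWithin]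
      with r hr hr0
    have hr0 : 0 < r := hr0
    refine hη.trans_le ((ENNReal.le_div_iff_mul_le (Or.inl ?_) (Or.inl ?_)).2 hr.1)
    · exact mul_ne_zero (ENNReal.ofReal_pos.2 (by positivity)).ne' hκ0
    · exact ENNReal.mul_ne_top ENNReal.ofReal_ne_top hκt
  · obtain ⟨η, hη, h1, h2⟩ := ((hu.eventually_lt_const ha).and hsmall).exists
    filter_upwards [h.eventually_volume_bounds hW hx₀ hWU hanti h1 h2] with r hr
    exact (ENNReal.div_le_of_le_mul hr.2).trans_lt hη

end Density

/-! ### Restriction and uniqueness of weak derivatives -/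

section Weak

variable {n : ℕ} {F : Type*} [NormedAddCommGroup F] [NormedSpace ℝ F]
  {U V : Set (Eucl n)} {f f' : Eucl n → F} {G G' : Eucl n → (Eucl n →L[ℝ] F)}

lemma setIntegral_smul_eq_of_tsupport_subset {ψ : Eucl n → ℝ} {H : Eucl n → F}
    (hψ : tsupport ψ ⊆ U) : ∫ x in U, ψ x • H x = ∫ x, ψ x • H x := by
  refine setIntegral_eq_integral_of_forall_compl_eq_zero fun x hx => ?_
  rw [image_eq_zero_of_notMem_tsupport fun h => hx (hψ h), zero_smul]

lemma setIntegral_fderiv_smul_eq_of_tsupport_subset {ψ : Eucl n → ℝ} {H : Eucl n → F}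
    (hψ : tsupport ψ ⊆ U) (v : Eucl n) :
    ∫ x in U, (fderiv ℝ ψ x v) • H x = ∫ x, (fderiv ℝ ψ x v) • H x := by
  refine setIntegral_eq_integral_of_forall_compl_eq_zero fun x hx => ?_
  rw [image_eq_zero_of_notMem_tsupport fun h => hx (hψ (tsupport_fderiv_subset ℝ h)),
    zero_apply, zero_smul]

lemma HasWeakFDerivOn.mono (h : HasWeakFDerivOn U f G) (hVU : V ⊆ U) :
    HasWeakFDerivOn V f G where
  locallyIntegrableOn := h.locallyIntegrableOn.mono_set hVU
  locallyIntegrableOn_deriv := h.locallyIntegrableOn_deriv.mono_set hVU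
  integral_eq ψ h1 h2 h3 v := by
    have := h.integral_eq ψ h1 h2 (h3.trans hVU) v
    rw [setIntegral_fderiv_smul_eq_of_tsupport_subset (h3.trans hVU),
      setIntegral_smul_eq_of_tsupport_subset (h3.trans hVU)] at this
    rwa [setIntegral_fderiv_smul_eq_of_tsupport_subset h3,
      setIntegral_smul_eq_of_tsupport_subset h3]

lemma integrable_smul_of_locallyIntegrableOn {ψ : Eucl n → ℝ} {H : Eucl n → F}
    (hH : LocallyIntegrableOn H U) (hψ : Continuous ψ) (hψc : HasCompactSupport ψ)
    (hψU : tsupport ψ ⊆ U) : Integrable fun x => ψ x • H x := by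
  obtain ⟨C, hC⟩ := hψc.exists_bound_of_continuous hψ
  have h1 : IntegrableOn (fun x => ψ x • H x) (tsupport ψ) :=
    (hH.integrableOn_compact_subset hψU hψc).bdd_smul C hψ.aestronglyMeasurable
      (Eventually.of_forall hC)
  refine (integrableOn_iff_integrable_of_support_subset fun x hx => ?_).1 h1
  by_contra hx'
  exact hx (by simp [image_eq_zero_of_notMem_tsupport hx'])

/-- Weak derivatives of functions which agree on an open set agree almost everywhere there. -/
lemma HasWeakFDerivOn.ae_eq [CompleteSpace F] (hU : IsOpen U) (h : HasWeakFDerivOn U f G)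
    (h' : HasWeakFDerivOn U f' G') (hff' : EqOn f f' U) : ∀ᵐ x, x ∈ U → G x = G' x := by
  have key := hU.ae_eq_zero_of_integral_contDiff_smul_eq_zero
    (h.locallyIntegrableOn_deriv.sub h'.locallyIntegrableOn_deriv) (μ := volume) ?_
  · filter_upwards [key] with x hx hxU
    exact sub_eq_zero.1 (hx hxU)
  intro ψ h1 h2 h3
  have i1 := integrable_smul_of_locallyIntegrableOn h.locallyIntegrableOn_deriv h1.continuous h2 h3
  have i2 := integrable_smul_of_locallyIntegrableOn h'.locallyIntegrableOn_deriv h1.continuous h2 h3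
  have e : ∀ x, ψ x • (G - G') x = ψ x • G x - ψ x • G' x := fun x => by
    simp [smul_sub]
  simp_rw [e]
  rw [integral_sub i1 i2, sub_eq_zero]
  ext v
  rw [ContinuousLinearMap.integral_apply i1, ContinuousLinearMap.integral_apply i2]
  have e1 := h.integral_eq ψ h1 h2 h3 v
  have e2 := h'.integral_eq ψ h1 h2 h3 v
  rw [setIntegral_congr_fun hU.measurableSet
    (fun x hx => by rw [hff' hx] : EqOn _ (fun x => (fderiv ℝ ψ x v) • f' x) U), e2,
    setIntegral_smul_eq_of_tsupport_subset h3, setIntegral_smul_eq_of_tsupport_subset h3] at e1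
  exact (neg_injective e1).symm

lemma oscModulus_mono_of_ae_eq (hVU : V ⊆ U) (hGG' : ∀ᵐ x, x ∈ V → f x = f' x) (r : ℝ) :
    oscModulus V f r ≤ oscModulus U f' r := by
  unfold oscModulus
  refine iSup_mono fun x => iSup_mono fun ρ => iSup_le fun hρ => ?_
  refine le_iSup_of_le ⟨hρ.1, hρ.2.1, hρ.2.2.trans hVU⟩ (le_of_eq ?_)
  have hae : ∀ᵐ y ∂volume.restrict (Metric.ball x ρ), f y = f' y := by
    filter_upwards [ae_restrict_of_ae hGG', ae_restrict_mem measurableSet_ball] with y h1 h2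
    exact h1 (hρ.2.2 h2)
  rw [average_congr hae]
  refine laverage_congr ?_
  filter_upwards [hae] with y hy
  rw [hy]

end Weak

/-! ### The volume measure in a chart -/

lemma measurableSet_target_inter_preimage {n : ℕ} {M : Type*} [TopologicalSpace M]
    [MeasurableSpace M] [BorelSpace M]
    (e : OpenPartialHomeomorph M (Eucl n)) {A : Set M} (hA : MeasurableSet A) :
    MeasurableSet (e.target ∩ e.symm ⁻¹' A) := by
  have h1 : Measurable (e.target.domRestrict e.symm) :=
    (continuousOn_iff_continuous_domRestrict.1 e.continuousOn_symm).measurable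
  have h2 := e.open_target.measurableSet.subtype_image (h1 hA)
  convert h2 using 1
  ext x
  simp [domRestrict, and_comm]

section ChartVolume

variable {n : ℕ} {M : Type*} [TopologicalSpace M] [ChartedSpace (EuclideanSpace ℝ (Fin n)) M]
  {F : Type*} [NormedAddCommGroup F]

/-- The field of linear maps `D` read in the chart `e`, that is, `D ∘ d(e⁻¹)`. -/
noncomputable def coordDeriv [NormedSpace ℝ F] (e : OpenPartialHomeomorph M (Eucl n))
    (D : ∀ q : M, TangentSpace (𝓡 n) q →L[ℝ] F) (x : Eucl n) : Eucl n →L[ℝ] F :=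
  (D (e.symm x)).comp (mfderiv (𝓡 n) (𝓡 n) e.symm x)

variable [InnerProductSpace ℝ F]

lemma sqrt_det_chartGram (e : OpenPartialHomeomorph M (Eucl n))
    (D : ∀ q : M, TangentSpace (𝓡 n) q →L[ℝ] F) (x : Eucl n) :
    Real.sqrt (chartGram e (fun q X Y => inner ℝ (D q X) (D q Y)) x).det =
      jacobian (coordDeriv e D x) := rfl

lemma chartVolume_apply [MeasurableSpace M] [BorelSpace M]
    (e : OpenPartialHomeomorph M (Eucl n))
    (g : ∀ q : M, TangentSpace (𝓡 n) q → TangentSpace (𝓡 n) q → ℝ) {A : Set M}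
    (hA : MeasurableSet A) :
    chartVolume e g A = ∫⁻ x in e.target ∩ e.symm ⁻¹' A,
      ENNReal.ofReal (Real.sqrt (chartGram e g x).det) := by
  have hm : AEMeasurable e.symm ((volume.restrict e.target).withDensity
      fun x => ENNReal.ofReal (Real.sqrt (chartGram e g x).det)) :=
    (e.continuousOn_symm.aemeasurable e.open_target.measurableSet).mono_ac
      (withDensity_absolutelyContinuous _ _)
  have hS := measurableSet_target_inter_preimage e hA
  have htc : ((volume.restrict e.target).withDensity
      fun x => ENNReal.ofReal (Real.sqrt (chartGram e g x).det)) e.targetᶜ = 0 := by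
    refine withDensity_absolutelyContinuous _ _ ?_
    rw [Measure.restrict_apply e.open_target.measurableSet.compl, compl_inter_self, measure_empty]
  rw [chartVolume, Measure.map_apply_of_aemeasurable hm hA]
  have : ((volume.restrict e.target).withDensity
      fun x => ENNReal.ofReal (Real.sqrt (chartGram e g x).det)) (e.symm ⁻¹' A) =
      ((volume.restrict e.target).withDensity
      fun x => ENNReal.ofReal (Real.sqrt (chartGram e g x).det)) (e.target ∩ e.symm ⁻¹' A) := by
    refine le_antisymm ?_ (measure_mono inter_subset_right)
    refine (measure_mono (fun x hx => ?_ : e.symm ⁻¹' A ⊆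
      (e.target ∩ e.symm ⁻¹' A) ∪ e.targetᶜ)).trans ((measure_union_le _ _).trans ?_)
    · by_cases h : x ∈ e.target
      · exact Or.inl ⟨h, hx⟩
      · exact Or.inr h
    · rw [htc, add_zero]
  rw [this, withDensity_apply _ hS, Measure.restrict_restrict hS,
    inter_eq_left.2 (inter_subset_left : e.target ∩ e.symm ⁻¹' A ⊆ e.target)]

/-- The transition from the chart `e` to the chart `e'` transforms the coordinate expressions
of a field of linear maps by the chain rule. -/
lemma exists_hasFDerivAt_transition {e e' : OpenPartialHomeomorph M (Eucl n)}
    (he : e ∈ IsManifold.maximalAtlas (𝓡 n) ∞ M) (he' : e' ∈ IsManifold.maximalAtlas (𝓡 n) ∞ M)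
    (D : ∀ q : M, TangentSpace (𝓡 n) q →L[ℝ] F) {x : Eucl n} (hx : x ∈ e.target)
    (hx' : e.symm x ∈ e'.source) :
    ∃ T : Eucl n →L[ℝ] Eucl n, HasFDerivAt (e' ∘ e.symm) T x ∧
      coordDeriv e D x = (coordDeriv e' D (e' (e.symm x))).comp T := by
  have h1 : MDifferentiableAt (𝓡 n) (𝓡 n) e.symm x :=
    (contMDiffAt_symm_of_mem_maximalAtlas he hx).mdifferentiableAt (by simp)
  have h2 : MDifferentiableAt (𝓡 n) (𝓡 n) e' (e.symm x) :=
    (contMDiffAt_of_mem_maximalAtlas he' hx').mdifferentiableAt (by simp)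
  have h3 : MDifferentiableAt (𝓡 n) (𝓡 n) e'.symm ((e' ∘ e.symm) x) :=
    (contMDiffAt_symm_of_mem_maximalAtlas he' (e'.map_source hx')).mdifferentiableAt (by simp)
  have h4 : MDifferentiableAt (𝓡 n) (𝓡 n) (e' ∘ e.symm) x := h2.comp x h1
  refine ⟨fderiv ℝ (e' ∘ e.symm) x, (mdifferentiableAt_iff_differentiableAt.1 h4).hasFDerivAt, ?_⟩
  have h5 : e'.symm ∘ (e' ∘ e.symm) =ᶠ[𝓝 x] e.symm := by
    have : e.symm ⁻¹' e'.source ∈ 𝓝 x :=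
      (e.continuousAt_symm hx).preimage_mem_nhds (e'.open_source.mem_nhds hx')
    filter_upwards [this] with z hz
    exact e'.left_inv hz
  have h6 := mfderiv_comp x h3 h4
  rw [mfderiv_eq_fderiv] at h6
  have h7 : (mfderiv (𝓡 n) (𝓡 n) (e'.symm ∘ (e' ∘ e.symm)) x : Eucl n →L[ℝ] Eucl n) =
    mfderiv (𝓡 n) (𝓡 n) e.symm x := h5.mfderiv_eq
  have h8 := h7.symm.trans h6
  -- `D` as a map into a fixed space of linear maps
  let D' : M → (Eucl n →L[ℝ] F) := D
  have h9 : D' (e'.symm (e' (e.symm x))) = D' (e.symm x) := congrArg D' (e'.left_inv hx')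
  ext v
  change D' (e.symm x) ((mfderiv (𝓡 n) (𝓡 n) e.symm x : Eucl n →L[ℝ] Eucl n) v) =
    D' (e'.symm (e' (e.symm x)))
      ((mfderiv (𝓡 n) (𝓡 n) e'.symm (e' (e.symm x)) : Eucl n →L[ℝ] Eucl n)
        (fderiv ℝ (e' ∘ e.symm) x v))
  rw [h9]
  exact congrArg (D' (e.symm x)) (DFunLike.congr_fun h8 v)

variable [MeasurableSpace M] [BorelSpace M]

/-- By the change of variables formula, the volume of a set contained in the domains of two charts
does not depend on the chart. -/
lemma chartVolume_eq_of_subset {e e' : OpenPartialHomeomorph M (Eucl n)}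
    (he : e ∈ IsManifold.maximalAtlas (𝓡 n) ∞ M) (he' : e' ∈ IsManifold.maximalAtlas (𝓡 n) ∞ M)
    (D : ∀ q : M, TangentSpace (𝓡 n) q →L[ℝ] F) {A : Set M} (hA : MeasurableSet A)
    (hAe : A ⊆ e.source) (hAe' : A ⊆ e'.source) :
    chartVolume e (fun q X Y => inner ℝ (D q X) (D q Y)) A =
      chartVolume e' (fun q X Y => inner ℝ (D q X) (D q Y)) A := by
  rw [chartVolume_apply e _ hA, chartVolume_apply e' _ hA]
  set S := e.target ∩ e.symm ⁻¹' A with hS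
  have hSm : MeasurableSet S := measurableSet_target_inter_preimage e hA
  have himg : (e' ∘ e.symm) '' S = e'.target ∩ e'.symm ⁻¹' A := by
    ext z
    constructor
    · rintro ⟨x, hx, rfl⟩
      have hx' := hAe' hx.2
      refine ⟨e'.map_source hx', ?_⟩
      rw [mem_preimage, Function.comp_apply, e'.left_inv hx']
      exact hx.2
    · rintro ⟨hz, hzA⟩
      have hz' := hAe hzA
      refine ⟨e (e'.symm z), ⟨e.map_source hz', ?_⟩, ?_⟩
      · rw [mem_preimage, e.left_inv hz']
        exact hzA
      · rw [Function.comp_apply, e.left_inv hz', e'.right_inv hz]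
  have hT : ∀ x ∈ S, ∃ T : Eucl n →L[ℝ] Eucl n, HasFDerivAt (e' ∘ e.symm) T x ∧
      coordDeriv e D x = (coordDeriv e' D (e' (e.symm x))).comp T := fun x hx =>
    exists_hasFDerivAt_transition he he' D hx.1 (hAe' hx.2)
  choose! T hT1 hT2 using hT
  have hinj : InjOn (e' ∘ e.symm) S := by
    intro x hx z hz hxz
    exact e.symm.injOn hx.1 hz.1 (e'.injOn (hAe' hx.2) (hAe' hz.2) hxz)
  rw [← himg, lintegral_image_eq_lintegral_abs_det_fderiv_mul volume hSm
    (fun x hx => (hT1 x hx).hasFDerivWithinAt) hinj]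
  refine setLIntegral_congr_fun hSm fun x hx => ?_
  rw [sqrt_det_chartGram, sqrt_det_chartGram, hT2 x hx, jacobian_comp,
    ENNReal.ofReal_mul (abs_nonneg _)]
  rfl

/-- On the domain of a chart the volume measure is given by the coordinate expression. -/
lemma volMeasure_apply_of_subset {e : OpenPartialHomeomorph M (Eucl n)}
    (he : e ∈ IsManifold.maximalAtlas (𝓡 n) ∞ M)
    (D : ∀ q : M, TangentSpace (𝓡 n) q →L[ℝ] F) {A : Set M} (hA : MeasurableSet A)
    (hAe : A ⊆ e.source) :
    volMeasure (fun q X Y => inner ℝ (D q X) (D q Y)) A =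
      ∫⁻ x in e.target ∩ e.symm ⁻¹' A, ENNReal.ofReal (jacobian (coordDeriv e D x)) := by
  set g : ∀ q : M, TangentSpace (𝓡 n) q → TangentSpace (𝓡 n) q → ℝ :=
    fun q X Y => inner ℝ (D q X) (D q Y) with hg
  have hval : chartVolume e g A =
      ∫⁻ x in e.target ∩ e.symm ⁻¹' A, ENNReal.ofReal (jacobian (coordDeriv e D x)) :=
    chartVolume_apply e g hA
  rw [← hval]
  refine le_antisymm ?_ ?_
  · -- all chart volumes are dominated by one measure, equal to that of `e` on its domain
    have hle : volMeasure g ≤ chartVolume e g + (⊤ : Measure M).restrict e.sourceᶜ := by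
      refine iSup₂_le fun e' he' => Measure.le_iff.2 fun s hs => ?_
      have hes := e.open_source.measurableSet
      have he's := e'.open_source.measurableSet
      rw [← measure_inter_add_sdiff s hes, Measure.add_apply]
      refine add_le_add ?_ ?_
      · have h0 : chartVolume e' g e'.sourceᶜ = 0 := by
          rw [chartVolume_apply e' g he's.compl]
          have : e'.target ∩ e'.symm ⁻¹' e'.sourceᶜ = ∅ := by
            ext x
            simp only [mem_inter_iff, mem_preimage, mem_compl_iff, mem_empty_iff_false,
              iff_false, not_and, not_not]
            exact fun hx => e'.map_target hx
          rw [this, Measure.restrict_empty, lintegral_zero_measure]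
        calc chartVolume e' g (s ∩ e.source)
            ≤ chartVolume e' g (s ∩ e.source ∩ e'.source) + chartVolume e' g e'.sourceᶜ := by
              refine (measure_mono fun x hx => ?_).trans (measure_union_le _ _)
              by_cases h : x ∈ e'.source
              · exact Or.inl ⟨hx, h⟩
              · exact Or.inr h
          _ = chartVolume e g (s ∩ e.source ∩ e'.source) := by
              rw [h0, add_zero]
              exact (chartVolume_eq_of_subset he he' D ((hs.inter hes).inter he's)
                (inter_subset_left.trans inter_subset_right) inter_subset_right).symm
          _ ≤ chartVolume e g s :=
              measure_mono (inter_subset_left.trans inter_subset_left)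
      · rw [Measure.restrict_apply hs, ← sdiff_eq]
        exact le_top (a := chartVolume e' g) (s \ e.source)
    have h1 := hle A
    rw [Measure.add_apply, Measure.restrict_apply hA] at h1
    have h2 : A ∩ e.sourceᶜ = ∅ := by
      rw [← sdiff_eq]
      exact sdiff_eq_empty.2 hAe
    rwa [h2, measure_empty, add_zero] at h1
  · exact le_iSup₂_of_le (f := fun e (_ : e ∈ IsManifold.maximalAtlas (𝓡 n) ∞ M) =>
      chartVolume e g) e he le_rfl A

end ChartVolume

/-! ### Coordinate bounds for the reference metric -/

section Metric

open scoped Bundle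

variable {n : ℕ} {M : Type*} [TopologicalSpace M] [ChartedSpace (EuclideanSpace ℝ (Fin n)) M]
  [IsManifold (𝓡 n) ∞ M]

/-- In the preferred chart at `p`, the metric `g₀` is comparable to the Euclidean metric near `p`,
and its volume density is bounded from below. -/
lemma exists_chart_metric_bounds
    (g₀ : Bundle.ContMDiffRiemannianMetric (𝓡 n) ∞ (EuclideanSpace ℝ (Fin n))
      (fun q : M => TangentSpace (𝓡 n) q)) (p : M) :
    ∃ c > 0, ∃ C > 0, ∀ᶠ x in 𝓝 (chartAt (Eucl n) p p),
      (∀ v : Eucl n,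
        c ^ 2 * ‖v‖ ^ 2 ≤ g₀.inner ((chartAt (Eucl n) p).symm x)
          (mfderiv (𝓡 n) (𝓡 n) (chartAt (Eucl n) p).symm x v)
          (mfderiv (𝓡 n) (𝓡 n) (chartAt (Eucl n) p).symm x v) ∧
        g₀.inner ((chartAt (Eucl n) p).symm x)
          (mfderiv (𝓡 n) (𝓡 n) (chartAt (Eucl n) p).symm x v)
          (mfderiv (𝓡 n) (𝓡 n) (chartAt (Eucl n) p).symm x v) ≤ C ^ 2 * ‖v‖ ^ 2) ∧
      c ^ n ≤ Real.sqrt (chartGram (chartAt (Eucl n) p)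
        (fun q X Y => g₀.inner q X Y) x).det := by
  let _ : Bundle.RiemannianBundle (fun q : M => TangentSpace (𝓡 n) q) := ⟨g₀.toRiemannianMetric⟩
  have : IsContinuousRiemannianBundle (Eucl n) (fun q : M => TangentSpace (𝓡 n) q) :=
    ⟨⟨g₀.inner, g₀.toContinuousRiemannianMetric.continuous, fun _ _ _ => rfl⟩⟩
  set e := chartAt (Eucl n) p with he
  obtain ⟨C₁, hC₁, h1⟩ := eventually_norm_trivializationAt_lt (Eucl n)
    (fun q : M => TangentSpace (𝓡 n) q) p
  obtain ⟨C₂, hC₂, h2⟩ := eventually_norm_symmL_trivializationAt_lt (Eucl n)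
    (fun q : M => TangentSpace (𝓡 n) q) p
  have hp : p ∈ e.source := mem_chart_source _ p
  have htend : Tendsto e.symm (𝓝 (e p)) (𝓝 p) := by
    have := e.continuousAt_symm (e.map_source hp)
    rwa [ContinuousAt, e.left_inv hp] at this
  refine ⟨C₁⁻¹, by positivity, C₂, hC₂, ?_⟩
  filter_upwards [htend.eventually h1, htend.eventually h2,
    e.open_target.mem_nhds (e.map_source hp)] with x hx1 hx2 hx
  have hq : e.symm x ∈ e.source := e.map_target hx
  set tr := trivializationAt (Eucl n) (fun q : M => TangentSpace (𝓡 n) q) p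
  have hbase : e.symm x ∈ tr.baseSet := hq
  let Ψ : Eucl n → (Eucl n →L[ℝ] Eucl n) := fun z => mfderiv (𝓡 n) (𝓡 n) e.symm z
  have hsymm : (tr.symmL ℝ (e.symm x) : Eucl n →L[ℝ] Eucl n) = Ψ x := by
    have h3 := TangentBundle.symmL_trivializationAt (I := 𝓡 n) hq
    have h4 : (mfderivWithin (𝓡 n) (𝓡 n) (extChartAt (𝓡 n) p).symm (range (𝓡 n))
        (extChartAt (𝓡 n) p (e.symm x)) : Eucl n →L[ℝ] Eucl n) = Ψ (e (e.symm x)) := by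
      have h5 : range (𝓡 n) = univ := by simp
      rw [h5, mfderivWithin_univ]
      rfl
    rw [e.right_inv hx] at h4
    exact h3.trans h4
  have hnorm : ∀ w : TangentSpace (𝓡 n) (e.symm x), g₀.inner (e.symm x) w w = ‖w‖ ^ 2 :=
    fun w => real_inner_self_eq_norm_sq w
  have hval : ∀ v : Eucl n, mfderiv (𝓡 n) (𝓡 n) e.symm x v = tr.symmL ℝ (e.symm x) v :=
    fun v => (DFunLike.congr_fun hsymm v).symm
  have hlow : ∀ v : Eucl n, C₁⁻¹ * ‖v‖ ≤ ‖tr.symmL ℝ (e.symm x) v‖ := by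
    intro v
    have h3 := (tr.continuousLinearMapAt ℝ (e.symm x)).le_of_opNorm_le hx1.le
      (tr.symmL ℝ (e.symm x) v)
    rw [tr.continuousLinearMapAt_symmL hbase] at h3
    rwa [inv_mul_le_iff₀ hC₁]
  refine ⟨fun v => ?_, ?_⟩
  · rw [hval v, hnorm, ← mul_pow, ← mul_pow]
    refine ⟨pow_le_pow_left₀ (by positivity) (hlow v) 2, pow_le_pow_left₀ (norm_nonneg _) ?_ 2⟩
    exact (tr.symmL ℝ (e.symm x)).le_of_opNorm_le hx2.le v
  · have h3 := pow_le_jacobian (tr.symmL ℝ (e.symm x)) (inv_pos.2 hC₁) hlow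
    have h4 : chartGram e (fun q X Y => g₀.inner q X Y) x = gram (tr.symmL ℝ (e.symm x)) := by
      ext i j
      simp only [chartGram, gram, Matrix.of_apply]
      rw [hval, hval]
      rfl
    rw [h4]
    exact h3

end Metric

/-! ### Weak immersions in coordinates -/

section Manifold

/-- A set which is null for `chartVolume` is Lebesgue null in coordinates, as far as the volume
density is bounded from below. -/
lemma ae_of_ae_chartVolume {n : ℕ} {M : Type*} [TopologicalSpace M]
    [ChartedSpace (EuclideanSpace ℝ (Fin n)) M] [MeasurableSpace M] [BorelSpace M]
    {e : OpenPartialHomeomorph M (Eucl n)}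
    {g : ∀ q : M, TangentSpace (𝓡 n) q → TangentSpace (𝓡 n) q → ℝ} {P : M → Prop}
    (hP : ∀ᵐ q ∂chartVolume e g, P q) {V : Set (Eucl n)} (hV : IsOpen V) (hVe : V ⊆ e.target)
    {b : ℝ} (hb : 0 < b) (hbV : ∀ x ∈ V, b ≤ Real.sqrt (chartGram e g x).det) :
    ∀ᵐ x, x ∈ V → P (e.symm x) := by
  obtain ⟨N, hN, hNm, hN0⟩ := exists_measurable_superset_of_null (ae_iff.1 hP)
  have hS : MeasurableSet (V ∩ (e.target ∩ e.symm ⁻¹' N)) :=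
    hV.measurableSet.inter (measurableSet_target_inter_preimage e hNm)
  rw [chartVolume_apply e g hNm] at hN0
  have h1 : ENNReal.ofReal b * volume (V ∩ (e.target ∩ e.symm ⁻¹' N)) ≤ 0 := by
    rw [← hN0, ← setLIntegral_const]
    exact (setLIntegral_mono' hS fun x hx => ENNReal.ofReal_le_ofReal (hbV x hx.1)).trans
      (lintegral_mono_set inter_subset_right)
  have h2 : volume (V ∩ (e.target ∩ e.symm ⁻¹' N)) = 0 :=
    (mul_eq_zero.1 (le_zero_iff.1 h1)).resolve_left (ENNReal.ofReal_pos.2 hb).ne'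
  rw [ae_iff]
  refine measure_mono_null (fun x hx => ?_) h2
  have hx : ¬(x ∈ V → P (e.symm x)) := hx
  rw [Classical.not_imp] at hx
  exact ⟨hx.1, hVe hx.1, hN hx.2⟩

variable {n m : ℕ} {M : Type*} [TopologicalSpace M]
  [ChartedSpace (EuclideanSpace ℝ (Fin n)) M] [IsManifold (𝓡 n) ∞ M]
  [MeasurableSpace M] [BorelSpace M]
  {g₀ : Bundle.ContMDiffRiemannianMetric (𝓡 n) ∞ (EuclideanSpace ℝ (Fin n))
      (fun q : M => TangentSpace (𝓡 n) q)}
  {Φ : M → EuclideanSpace ℝ (Fin m)}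
  {D : ∀ q : M, TangentSpace (𝓡 n) q →L[ℝ] EuclideanSpace ℝ (Fin m)}

/-- Near each point, a weak immersion with differential in VMO reads in the preferred chart as a
VMO immersion of a Euclidean open set. -/
lemma IsWeakImmersion.exists_isVMOImmersionOn [T2Space M] (himm : IsWeakImmersion g₀ Φ D)
    (hΦ : Continuous Φ) (hvmo : DifferentialIsVMO n Φ) (p : M) :
    ∃ (U : Set (Eucl n)) (lam Lam : ℝ), chartAt (Eucl n) p p ∈ U ∧
      U ⊆ (chartAt (Eucl n) p).target ∧
      IsVMOImmersionOn U (Φ ∘ (chartAt (Eucl n) p).symm) (coordDeriv (chartAt (Eucl n) p) D)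
        lam Lam := by
  obtain ⟨c, hc, C, hC, hbd⟩ := exists_chart_metric_bounds g₀ p
  set e := chartAt (Eucl n) p with he
  have hea : e ∈ IsManifold.maximalAtlas (𝓡 n) ∞ M := IsManifold.chart_mem_maximalAtlas p
  have hp : p ∈ e.source := mem_chart_source _ p
  -- a cutoff function which is one near `p`
  obtain ⟨ξ⟩ : Nonempty (SmoothBumpFunction (𝓡 n) p) := inferInstance
  obtain ⟨G', hG', -, hosc⟩ := hvmo e hea ξ ξ.contMDiff ξ.hasCompactSupport
    ξ.tsupport_subset_chartAt_source
  have htend : Tendsto e.symm (𝓝 (e p)) (𝓝 p) := by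
    have := e.continuousAt_symm (e.map_source hp)
    rwa [ContinuousAt, e.left_inv hp] at this
  obtain ⟨U, hU, hUo, hpU⟩ := eventually_nhds_iff.1
    ((hbd.and (htend.eventually ξ.eventuallyEq_one)).and
      (e.open_target.mem_nhds (e.map_source hp)))
  have hUe : U ⊆ e.target := fun x hx => (hU x hx).2
  have hw : HasWeakFDerivOn U (Φ ∘ e.symm) (coordDeriv e D) :=
    (himm.isWeakDifferential e hea).mono hUe
  have hG : ∀ᵐ x, x ∈ U → coordDeriv e D x = G' x := by
    refine hw.ae_eq hUo (hG'.mono hUe) fun x hx => ?_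
    have h1 : ξ (e.symm x) = 1 := (hU x hx).1.2
    simp [h1]
  obtain ⟨Λ, hΛ, himm'⟩ := himm.immersion
  have hae := ae_of_ae_chartVolume (e := e) (P := fun q => ∀ X : TangentSpace (𝓡 n) q,
      Λ⁻¹ * g₀.inner q X X ≤ ‖D q X‖ ^ 2 ∧ ‖D q X‖ ^ 2 ≤ Λ * g₀.inner q X X)
    ((Measure.absolutelyContinuous_of_le
      (le_iSup₂_of_le (f := fun e (_ : e ∈ IsManifold.maximalAtlas (𝓡 n) ∞ M) =>
        chartVolume e fun q X Y => g₀.inner q X Y) e hea le_rfl)).ae_le himm') hUo hUe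
    (pow_pos hc n) fun x hx => (hU x hx).1.1.2
  refine ⟨U, c / √Λ, √Λ * C, hpU, hUe, hUo, hΦ.comp_continuousOn
    (e.continuousOn_symm.mono hUe), hw, by positivity, by positivity, ?_, ?_⟩
  · filter_upwards [hae] with x hx hxU v
    have h1 := hx hxU (mfderiv (𝓡 n) (𝓡 n) e.symm x v)
    have h2 := (hU x hxU).1.1.1 v
    have h3 : coordDeriv e D x v = D (e.symm x) (mfderiv (𝓡 n) (𝓡 n) e.symm x v) := rfl
    rw [h3]
    constructor
    · refine le_of_sq_le_sq ?_ (norm_nonneg _)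
      refine le_trans ?_ h1.1
      rw [mul_pow, div_pow, Real.sq_sqrt hΛ.le, div_eq_inv_mul, mul_assoc]
      exact mul_le_mul_of_nonneg_left h2.1 (by positivity)
    · refine le_of_sq_le_sq ?_ (by positivity)
      refine h1.2.trans ?_
      rw [mul_pow, mul_pow, Real.sq_sqrt hΛ.le, mul_assoc]
      exact mul_le_mul_of_nonneg_left h2.2 (by positivity)
  · exact tendsto_of_tendsto_of_tendsto_of_le_of_le tendsto_const_nhds hosc
      (fun _ => zero_le) (oscModulus_mono_of_ae_eq hUe hG)

/-- Near each point, a weak immersion with differential in VMO is injective and has density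
one. -/
lemma IsWeakImmersion.exists_local_density [T2Space M] (himm : IsWeakImmersion g₀ Φ D)
    (hΦ : Continuous Φ) (hvmo : DifferentialIsVMO n Φ) (p : M) :
    ∃ W : Set M, IsOpen W ∧ p ∈ W ∧ (∀ q ∈ W, Φ q = Φ p → q = p) ∧
      ∀ W' ⊆ W, IsOpen W' → p ∈ W' → Tendsto (fun r : ℝ =>
        volMeasure (fun q X Y => inner ℝ (D q X) (D q Y)) (W' ∩ Φ ⁻¹' Metric.ball (Φ p) r) /
        (ENNReal.ofReal (r ^ n) * volume (Metric.ball (0 : Eucl n) 1))) (𝓝[>] 0) (𝓝 1) := by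
  obtain ⟨U, lam, Lam, hpU, hUe, h⟩ := himm.exists_isVMOImmersionOn hΦ hvmo p
  set e := chartAt (Eucl n) p with he
  have hea : e ∈ IsManifold.maximalAtlas (𝓡 n) ∞ M := IsManifold.chart_mem_maximalAtlas p
  have hp : p ∈ e.source := mem_chart_source _ p
  have hfp : (Φ ∘ e.symm) (e p) = Φ p := by rw [Function.comp_apply, e.left_inv hp]
  have hlam := h.lam_pos
  obtain ⟨δ, hδ, hδU, hanti⟩ := h.exists_antilipschitz hpU
  refine ⟨e.source ∩ e ⁻¹' Metric.ball (e p) δ, e.isOpen_inter_preimage Metric.isOpen_ball,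
    ⟨hp, Metric.mem_ball_self hδ⟩, fun q hq hqp => ?_, fun W' hW' hW'o hpW' => ?_⟩
  · have h1 := hanti (e p) (Metric.mem_ball_self hδ) (e q) hq.2
    rw [hfp, Function.comp_apply, e.left_inv hq.1, hqp, sub_self, norm_zero] at h1
    have h2 : ‖e q - e p‖ ≤ 0 := by nlinarith
    exact e.injOn hq.1 hp (sub_eq_zero.1 (norm_le_zero_iff.1 h2))
  · have hSδ : e.target ∩ e.symm ⁻¹' W' ⊆ Metric.ball (e p) δ := by
      rintro x ⟨hx, hxW⟩
      have := (hW' hxW).2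
      rwa [mem_preimage, e.right_inv hx] at this
    have hpS : e p ∈ e.target ∩ e.symm ⁻¹' W' :=
      ⟨e.map_source hp, by rwa [mem_preimage, e.left_inv hp]⟩
    have key := h.tendsto_density (e.isOpen_inter_preimage_symm hW'o) hpS (hSδ.trans hδU)
      fun x hx => hanti (e p) (Metric.mem_ball_self hδ) x (hSδ hx)
    refine key.congr fun r => ?_
    rw [hfp, volMeasure_apply_of_subset hea D
      (hW'o.inter (Metric.isOpen_ball.preimage hΦ)).measurableSet
      (inter_subset_left.trans (hW'.trans inter_subset_left)), inter_assoc]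
    rfl

end Manifold

end WeakImm

theorem mainTheorem6 {n m : ℕ} {M : Type*} [TopologicalSpace M] [CompactSpace M] [T2Space M]
    [ChartedSpace (EuclideanSpace ℝ (Fin n)) M] [IsManifold (𝓡 n) ∞ M]
    [MeasurableSpace M] [BorelSpace M]
    (g₀ : Bundle.ContMDiffRiemannianMetric (𝓡 n) ∞ (EuclideanSpace ℝ (Fin n))
      (fun q : M => TangentSpace (𝓡 n) q))
    (Φ : M → EuclideanSpace ℝ (Fin m)) (hΦ : Continuous Φ)
    (D : ∀ q : M, TangentSpace (𝓡 n) q →L[ℝ] EuclideanSpace ℝ (Fin m))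
    (himm : WeakImm.IsWeakImmersion g₀ Φ D)
    (hvmo : WeakImm.DifferentialIsVMO n Φ)
    (y : EuclideanSpace ℝ (Fin m)) :
    (Φ ⁻¹' {y}).Finite ∧
      WeakImm.HasDensityAt Φ D y ((Φ ⁻¹' {y}).ncard : ℝ≥0∞) := by
  choose W hWo hpW hinj hdens using himm.exists_local_density hΦ hvmo
  have hclosed : IsClosed (Φ ⁻¹' {y}) := isClosed_singleton.preimage hΦ
  have hfin : (Φ ⁻¹' {y}).Finite := by
    by_contra hinf
    obtain ⟨p, hp, hacc⟩ := Set.Infinite.exists_accPt_of_subset_isCompact hinf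
      hclosed.isCompact subset_rfl
    obtain ⟨q, ⟨hqW, hq⟩, hqp⟩ := accPt_iff_nhds.1 hacc (W p) ((hWo p).mem_nhds (hpW p))
    exact hqp (hinj p q hqW (by rw [mem_singleton_iff.1 hq, mem_singleton_iff.1 hp]))
  refine ⟨hfin, ?_⟩
  obtain ⟨V, hV, hdisj⟩ := hfin.t2_separation
  set μ := WeakImm.volMeasure (fun q X Y => inner ℝ (D q X) (D q Y)) with hμ
  set S := hfin.toFinset with hS
  have hmemS : ∀ p, p ∈ S ↔ Φ p = y := fun p => by simp [hS]
  set Z : M → Set M := fun p => V p ∩ W p with hZ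
  have hZo : ∀ p, IsOpen (Z p) := fun p => (hV p).2.inter (hWo p)
  -- the preimage of a small ball lies in the union of the chosen neighbourhoods
  obtain ⟨ε, hε, hεZ⟩ : ∃ ε > 0, Φ ⁻¹' Metric.ball y ε ⊆ ⋃ p ∈ S, Z p := by
    have hcl : IsClosed (Φ '' (⋃ p ∈ S, Z p)ᶜ) :=
      hΦ.isClosedMap _ (isOpen_biUnion fun p _ => hZo p).isClosed_compl
    have hy : y ∈ (Φ '' (⋃ p ∈ S, Z p)ᶜ)ᶜ := by
      rintro ⟨q, hq, hqy⟩
      exact hq (mem_biUnion ((hmemS q).2 hqy) ⟨(hV q).1, hpW q⟩)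
    obtain ⟨ε, hε, h⟩ := Metric.isOpen_iff.1 hcl.isOpen_compl y hy
    refine ⟨ε, hε, fun q hq => ?_⟩
    by_contra hq'
    exact h hq ⟨q, hq', rfl⟩
  have hsum : ∀ r ≤ ε, WeakImm.imageVolume Φ D (Metric.ball y r) =
      ∑ p ∈ S, μ (Z p ∩ Φ ⁻¹' Metric.ball y r) := by
    intro r hr
    have hm : ∀ p, MeasurableSet (Z p ∩ Φ ⁻¹' Metric.ball y r) := fun p =>
      ((hZo p).inter (Metric.isOpen_ball.preimage hΦ)).measurableSet
    rw [← measure_biUnion_finset _ fun p _ => hm p]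
    · have h1 : WeakImm.imageVolume Φ D (Metric.ball y r) = μ (Φ ⁻¹' Metric.ball y r) :=
        lintegral_indicator_one (Metric.isOpen_ball.preimage hΦ).measurableSet
      rw [h1, ← iUnion₂_inter, inter_eq_right.2]
      exact (preimage_mono (Metric.ball_subset_ball hr)).trans hεZ
    · intro p hp q hq hpq
      exact (hdisj ((hmemS p).1 hp) ((hmemS q).1 hq) hpq).mono
        (inter_subset_left.trans inter_subset_left) (inter_subset_left.trans inter_subset_left)
  have hlim := tendsto_finsetSum S fun p hp =>
    hdens p (Z p) inter_subset_right (hZo p) ⟨(hV p).1, hpW p⟩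
  have hcard : ∑ p ∈ S, (1 : ℝ≥0∞) = ((Φ ⁻¹' {y}).ncard : ℝ≥0∞) := by
    rw [Finset.sum_const, nsmul_one, Set.ncard_eq_toFinset_card _ hfin]
  rw [hcard] at hlim
  refine hlim.congr' ?_
  filter_upwards [(eventually_lt_nhds hε).filter_mono nhdsWithin_le_nhds] with r hr
  rw [hsum r hr.le]
  simp only [div_eq_mul_inv]
  rw [Finset.sum_mul]
  refine Finset.sum_congr rfl fun p hp => ?_
  rw [(hmemS p).1 hp]
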